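/- Let $n,r\ge 0$ be integers, let $k$ be an algebraically closed field, $V=k^r$, and let $\mathcal F$ be the variety of partial $n$-step flags $\{0\}=V_0\subseteq V_1\subseteq\cdots\subseteq V_n=V$. The group $\mathrm{GL}(V)$ acts diagonally on $\mathcal F\times\mathcal F$. The orbit of a pair $(f,f')=((V_i),(V'_j))$ is denoted by $e_A$, where $A=(a_{ij})$ is the $n\times n$ matrix with $a_{ij}=\dim(V_{i-1}+V_i\cap V'_j)-\dim(V_{i-1}+V_i\cap V'_{j-1})$; this identifies the orbits with the $n\times n$ matrices of non-negative integers with sum of entries $r$. Let $R$ be a nonzero commutative ring (for instance $\mathbb Z$ or a field). The $0$-Schur algebra $S_0(n,r)$ over $R$ is the free $R$-module with basis the set of orbits $e_A$, with the $R$-bilinear multiplication for which $e_A e_B$ is the unique orbit that is open (in the Zariski topology) in the set $$\{(f,h)\in\mathcal F\times\mathcal F \mid \text{there is } g\in\mathcal F \text{ with } (f,g)\in e_A \text{ and } (g,h)\in e_B\}$$ if this set is non-empty, and $e_Ae_B=0$ otherwise. For a composition $\lambda=(\lambda_1,\dots,\lambda_n)$ of $r$ into $n$ non-negative parts let $k_\lambda=e_{\mathrm{diag}(\lambda)}$,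 and call $k_\lambda$ a boundary idempotent if some $\lambda_i=0$. Let $I(n,r)$ be the two-sided ideal of $S_0(n,r)$ generated by the boundary idempotents. Then: (0) $I(n,r)$ has as an $R$-basis the elements $e_A$ for which at least one diagonal entry of $A$ is $0$. (1) $I(n,r)$ is free of finite rank over $R$, and $$\dim I(n,r)=\sum_{s=1}^n\binom ns\binom{n^2+r-n-1}{r+s-n}.$$ (2) $S_0(n,r)/I(n,r)$ is free of finite rank over $R$, and $$\dim S_0(n,r)/I(n,r)=\binom{n^2+r-n-1}{r-n}.$$ Here $\dim$ is the rank over $R$, and $\binom ab=a(a-1)\cdots(a-b+1)/b!$ for integers $a$ and $b\ge0$, while $\binom ab=0$ for $b<0$. -/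

import Mathlib

/-- The binomial coefficient `a(a-1)⋯(a-b+1)/b!` for integers `a`, `b`, which is `0` for `b < 0`. -/
def intBinom (a b : ℤ) : ℤ :=
  if b < 0 then 0 else Ring.choose a b.toNat

namespace ZeroSchur

universe u v

open scoped Topology

/-- A partial `n`-step flag `{0} = V_0 ⊆ V_1 ⊆ ⋯ ⊆ V_n = V` in `V = k^r`. -/
@[ext]
structure Flag (k : Type u) [Field k] (n r : ℕ) where
  space : Fin (n + 1) → Submodule k (Fin r → k)
  mono : Monotone space
  space_zero : space 0 = ⊥
  space_last : space (Fin.last n) = ⊤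

variable {k : Type u} [Field k] {n r : ℕ}

/-- The natural action of `GL(V)` on flags, by taking images of subspaces. -/
instance : MulAction (Matrix.GeneralLinearGroup (Fin r) k) (Flag k n r) where
  smul g f :=
    { space := fun i => (f.space i).map (Matrix.mulVecLin g.val)
      mono := fun _ _ h => Submodule.map_mono (f.mono h)
      space_zero := by rw [f.space_zero, Submodule.map_bot]
      space_last := by
        rw [f.space_last, Submodule.map_top, LinearMap.range_eq_top]
        intro v
        exact ⟨Matrix.mulVec g⁻¹.val v, by
          rw [Matrix.mulVecLin_apply, Matrix.mulVec_mulVec, ← Units.val_mul, mul_inv_cancel,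
            Units.val_one, Matrix.one_mulVec]⟩ }
  one_smul f := by
    ext1
    funext i
    change (f.space i).map (Matrix.mulVecLin (1 : Matrix (Fin r) (Fin r) k)) = f.space i
    rw [Matrix.mulVecLin_one, Submodule.map_id]
  mul_smul g h f := by
    ext1
    funext i
    change (f.space i).map (Matrix.mulVecLin (g.val * h.val)) =
      ((f.space i).map (Matrix.mulVecLin h.val)).map (Matrix.mulVecLin g.val)
    rw [Matrix.mulVecLin_mul, Submodule.map_comp]

theorem smul_space (g : Matrix.GeneralLinearGroup (Fin r) k) (f : Flag k n r) (i : Fin (n + 1)) :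
    (g • f).space i = (f.space i).map (Matrix.mulVecLin g.val) := rfl

theorem mulVecLin_injective (g : Matrix.GeneralLinearGroup (Fin r) k) :
    Function.Injective (Matrix.mulVecLin g.val) :=
  Matrix.mulVec_injective_iff_isUnit.mpr g.isUnit

/-- The matrix `A(f, f')` of a pair of flags:
`a_ij = dim (V_{i-1} + V_i ∩ V'_j) - dim (V_{i-1} + V_i ∩ V'_{j-1})`. The index `i : Fin n` stands
for the usual index `i + 1`. The second space lies in the first, so the subtraction is exact. -/
noncomputable def relMatrix (p : Flag k n r × Flag k n r) : Matrix (Fin n) (Fin n) ℕ :=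
  Matrix.of fun i j =>
    Module.finrank k ↥(p.1.space i.castSucc ⊔ p.1.space i.succ ⊓ p.2.space j.succ) -
      Module.finrank k ↥(p.1.space i.castSucc ⊔ p.1.space i.succ ⊓ p.2.space j.castSucc)

theorem relMatrix_smul (g : Matrix.GeneralLinearGroup (Fin r) k) (p : Flag k n r × Flag k n r) :
    relMatrix (g • p) = relMatrix p := by
  have hdim : ∀ W₁ W₂ W₃ : Submodule k (Fin r → k),
      Module.finrank k ↥(W₁.map (Matrix.mulVecLin g.val) ⊔
        W₂.map (Matrix.mulVecLin g.val) ⊓ W₃.map (Matrix.mulVecLin g.val)) =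
      Module.finrank k ↥(W₁ ⊔ W₂ ⊓ W₃) := fun W₁ W₂ W₃ => by
    rw [← Submodule.map_inf _ (mulVecLin_injective g), ← Submodule.map_sup]
    exact (Submodule.equivMapOfInjective _ (mulVecLin_injective g) _).finrank_eq.symm
  ext i j
  exact congrArg₂ (· - ·) (hdim _ _ _) (hdim _ _ _)

/-- The set of `GL(V)`-orbits in the double flag variety, for the diagonal action. -/
abbrev Orbit (k : Type u) [Field k] (n r : ℕ) : Type u :=
  MulAction.orbitRel.Quotient (Matrix.GeneralLinearGroup (Fin r) k) (Flag k n r × Flag k n r)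

/-- The matrix `A` for which the given orbit is `e_A`. -/
noncomputable def Orbit.matrix (O : Orbit k n r) : Matrix (Fin n) (Fin n) ℕ :=
  Quotient.lift relMatrix
    (by rintro _ p ⟨g, rfl⟩; exact relMatrix_smul g p) O

/-- The Zariski topology on the affine space `k^σ`. -/
abbrev zariski (k : Type u) [Field k] (σ : Type) : TopologicalSpace (σ → k) :=
  TopologicalSpace.generateFrom
    {U | ∃ p : MvPolynomial σ k, U = {x | MvPolynomial.eval x p ≠ 0}}

/-- The Zariski topology on `GL(V) × GL(V)`, an open subvariety of the affine space of pairs of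
matrices. -/
abbrev zariskiGL (k : Type u) [Field k] (r : ℕ) : TopologicalSpace
    (Matrix.GeneralLinearGroup (Fin r) k × Matrix.GeneralLinearGroup (Fin r) k) :=
  TopologicalSpace.induced
    (fun g => Sum.elim (fun e : Fin r × Fin r => g.1.val e.1 e.2)
      (fun e : Fin r × Fin r => g.2.val e.1 e.2))
    (zariski k ((Fin r × Fin r) ⊕ (Fin r × Fin r)))

/-- The Zariski topology on the double flag variety. The variety is the disjoint union of the
homogeneous spaces `(GL(V) × GL(V)) / (P × Q)`; the topology is the final one for the orbit maps
`(x, y) ↦ (x f, y f')`. -/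
abbrev zariskiFlags (k : Type u) [Field k] (n r : ℕ) :
    TopologicalSpace (Flag k n r × Flag k n r) :=
  ⨆ p : Flag k n r × Flag k n r,
    TopologicalSpace.coinduced (fun g => (g.1 • p.1, g.2 • p.2)) (zariskiGL k r)

/-- The set `π Δ⁻¹(O₁ × O₂)`. -/
def composites (O₁ O₂ : Orbit k n r) : Set (Flag k n r × Flag k n r) :=
  {p | ∃ g : Flag k n r, (p.1, g) ∈ O₁.orbit ∧ (g, p.2) ∈ O₂.orbit}

/-- The orbit `O` is contained in `Z` and open in `Z`, in the subspace topology. -/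
def IsOpenOrbitIn (O : Orbit k n r) (Z : Set (Flag k n r × Flag k n r)) : Prop :=
  ∃ U, IsOpen[zariskiFlags k n r] U ∧ U ∩ Z = O.orbit

/-- The underlying module of the `0`-Schur algebra with coefficients in `R`: the free module
on the set of orbits. -/
def Alg (k : Type u) [Field k] (R : Type v) [CommRing R] (n r : ℕ) : Type (max u v) :=
  Orbit k n r →₀ R

variable {R : Type v} [CommRing R]

noncomputable instance : AddCommGroup (Alg k R n r) :=
  inferInstanceAs (AddCommGroup (Orbit k n r →₀ R))

noncomputable instance : Module R (Alg k R n r) :=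
  inferInstanceAs (Module R (Orbit k n r →₀ R))

/-- The basis of the `0`-Schur algebra given by the orbits. -/
noncomputable def orbitBasis (k : Type u) [Field k] (R : Type v) [CommRing R] (n r : ℕ) :
    Module.Basis (Orbit k n r) R (Alg k R n r) :=
  Module.Basis.ofRepr (LinearEquiv.refl R (Orbit k n r →₀ R))

open Classical in
/-- The product of two orbits: the unique open orbit in `π Δ⁻¹(O₁ × O₂)`. If the second flags of
`O₁` are not isomorphic to the first flags of `O₂`, then this set is empty, contains no orbit, and
the product is `0`. -/
noncomputable def orbitMul (k : Type u) [Field k] (R : Type v) [CommRing R] {n r : ℕ}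
    (O₁ O₂ : Orbit k n r) : Alg k R n r :=
  if h : ∃! O : Orbit k n r, IsOpenOrbitIn O (composites O₁ O₂)
  then orbitBasis k R n r h.choose else 0

/-- The multiplication of the `0`-Schur algebra, the bilinear extension of the product of orbits. -/
noncomputable def mulBilin (k : Type u) [Field k] (R : Type v) [CommRing R] (n r : ℕ) :
    Alg k R n r →ₗ[R] Alg k R n r →ₗ[R] Alg k R n r :=
  (orbitBasis k R n r).constr R fun O₁ =>
    (orbitBasis k R n r).constr R fun O₂ => orbitMul k R O₁ O₂

noncomputable instance : NonUnitalNonAssocRing (Alg k R n r) where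
  __ := (inferInstance : AddCommGroup (Alg k R n r))
  mul x y := mulBilin k R n r x y
  left_distrib x y z := map_add (mulBilin k R n r x) y z
  right_distrib x y z := LinearMap.map_add₂ (mulBilin k R n r) x y z
  zero_mul x := LinearMap.map_zero₂ (mulBilin k R n r) x
  mul_zero x := map_zero (mulBilin k R n r x)

/-- The boundary idempotents `k_λ`: the basis elements `e_A` where `A` is the diagonal matrix with
entries `λ`, for a composition `λ` that has a zero component. -/
def boundaryIdempotents (k : Type u) [Field k] (R : Type v) [CommRing R] (n r : ℕ) :
    Set (Alg k R n r) :=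
  {x | ∃ (O : Orbit k n r) (l : Fin n → ℕ), (∃ i, l i = 0) ∧ O.matrix = Matrix.diagonal l ∧
    x = orbitBasis k R n r O}

/-- The two-sided ideal `I(n, r)` generated by the boundary idempotents: the smallest submodule
that contains them and is closed under left and right multiplication by all elements. -/
noncomputable def boundaryIdeal (k : Type u) [Field k] (R : Type v) [CommRing R] (n r : ℕ) :
    Submodule R (Alg k R n r) :=
  sInf {J | boundaryIdempotents k R n r ⊆ J ∧ ∀ x : Alg k R n r, ∀ y ∈ J, x * y ∈ J ∧ y * x ∈ J}

end ZeroSchur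

/-! For subspaces put d(X, Y) = dim (X + Y)/Y; it satisfies the triangle inequality. The matrix A of
a pair of flags is the mixed second difference of the numbers d(V_i, V'_j) (`gap`). A basis adapted
to both flags has a_ij vectors in cell (i, j), so A, and hence `gap`, determines the orbit. Since
dim (V_i + V'_j) is lower semicontinuous and the set of composites of two orbits is irreducible, an
orbit open in that set is the one whose gaps are all maximal.

The orbits with a zero on the diagonal span an ideal. Indeed the gaps of an open composite are the
min-plus product of those of the factors: the triangle inequality gives one bound, and a generic
choice attains it (`IsOpenOrbitIn.exists_gap_add_eq`). If the composite has no zero on its diagonal,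
the minimum at (j, j) is attained at the middle index j, and then each diagonal entry of the
composite is at most that of either factor (`relMatrix_diag_le`).

Conversely, if a_ii = 0 for (f, h), an explicit flag g (`middleFlag`) makes the triangle inequality
sharp for every pair of indices, so e_(f,h) = e_(f,g) e_(g,g) e_(g,h). Step i of g is trivial, so
e_(g,g) is a boundary idempotent.

Hence the zero-diagonal orbits are a basis of the ideal and the others give a basis of the quotient.
Subtracting the identity matrix counts the latter; the rank of the ideal follows from the total
number of matrices by Vandermonde's identity. -/

open Module
open scoped Topology Matrix

/-! ### Relative dimension of subspaces as a directed distance. -/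

namespace Submodule

variable {k V : Type*} [Field k] [AddCommGroup V] [Module k V]

/-- The dimension of `(X + Y) / Y`. -/
noncomputable def relDim (X Y : Submodule k V) : ℤ :=
  (finrank k ↥(X ⊔ Y) : ℤ) - finrank k Y

/-- One of three situations in which the triangle inequality through W is an equality; the others
are `relDim_add_of_inf_le` and `relDim_add_of_sup_inf_eq`. -/
theorem relDim_add_of_le_sup {X W Y : Submodule k V} (h1 : X ≤ W) (h2 : W ≤ X ⊔ Y) :
    relDim X W + relDim W Y = relDim X Y := by
  have h : W ⊔ Y = X ⊔ Y := le_antisymm (sup_le h2 le_sup_right) (sup_le_sup_right h1 _)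
  unfold relDim
  rw [h, sup_eq_right.2 h1]
  ring

variable [FiniteDimensional k V]

theorem relDim_eq_sub_inf (X Y : Submodule k V) :
    relDim X Y = (finrank k X : ℤ) - finrank k ↥(X ⊓ Y) := by
  have := finrank_sup_add_finrank_inf_eq X Y
  unfold relDim
  omega

/-- The sum and intersection formula for X + W and W + Y, whose intersection contains W and whose
sum contains X + Y. -/
theorem relDim_triangle (X W Y : Submodule k V) :
    relDim X Y ≤ relDim X W + relDim W Y := by
  have h1 := finrank_sup_add_finrank_inf_eq (X ⊔ W) (W ⊔ Y)
  have h2 : finrank k W ≤ finrank k ↥((X ⊔ W) ⊓ (W ⊔ Y)) :=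
    finrank_mono (le_inf le_sup_right le_sup_left)
  have h3 : finrank k ↥(X ⊔ Y) ≤ finrank k ↥((X ⊔ W) ⊔ (W ⊔ Y)) :=
    finrank_mono (sup_le_sup le_sup_left le_sup_right)
  unfold relDim
  omega

theorem relDim_add_of_inf_le {X W Y : Submodule k V} (h1 : X ⊓ Y ≤ W) (h2 : W ≤ X) :
    relDim X W + relDim W Y = relDim X Y := by
  have h : W ⊓ Y = X ⊓ Y := le_antisymm (inf_le_inf_right _ h2) (le_inf h1 inf_le_right)
  rw [relDim_eq_sub_inf, relDim_eq_sub_inf, relDim_eq_sub_inf, h, inf_eq_right.2 h2]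
  ring

theorem relDim_add_of_sup_inf_eq {X W Y : Submodule k V} (h1 : X ⊓ Y ≤ W)
    (h2 : W ≤ X ⊓ W ⊔ W ⊓ Y) : relDim X W + relDim W Y = relDim X Y := by
  have e1 : (X ⊓ W) ⊓ (W ⊓ Y) = X ⊓ Y :=
    le_antisymm (inf_le_inf inf_le_left inf_le_right)
      (le_inf (le_inf inf_le_left h1) (le_inf h1 inf_le_right))
  have e2 : (X ⊓ W) ⊔ (W ⊓ Y) = W := le_antisymm (sup_le inf_le_right inf_le_left) h2
  have := finrank_sup_add_finrank_inf_eq (X ⊓ W) (W ⊓ Y)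
  rw [e1, e2] at this
  rw [relDim_eq_sub_inf, relDim_eq_sub_inf, relDim_eq_sub_inf]
  omega

/-- Submodularity: X ∩ W and X' ∩ W' meet in X' ∩ W and both lie in X ∩ W'. -/
theorem relDim_cross {X' X W W' : Submodule k V} (hX : X' ≤ X) (hW : W ≤ W') :
    relDim X W' + relDim X' W ≤ relDim X W + relDim X' W' := by
  have e1 : (X ⊓ W) ⊓ (X' ⊓ W') = X' ⊓ W :=
    le_antisymm (le_inf (inf_le_right.trans inf_le_left) (inf_le_left.trans inf_le_right))
      (le_inf (inf_le_inf_right _ hX) (inf_le_inf_left _ hW))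
  have h2 : finrank k ↥((X ⊓ W) ⊔ (X' ⊓ W')) ≤ finrank k ↥(X ⊓ W') :=
    finrank_mono (sup_le (inf_le_inf_left _ hW) (inf_le_inf_right _ hX))
  have := finrank_sup_add_finrank_inf_eq (X ⊓ W) (X' ⊓ W')
  rw [e1] at this
  simp only [relDim_eq_sub_inf]
  omega

theorem finrank_sup_inf_of_le {X' X Y : Submodule k V} (hX : X' ≤ X) :
    finrank k ↥(X' ⊔ X ⊓ Y) + finrank k ↥(X' ⊓ Y) = finrank k X' + finrank k ↥(X ⊓ Y) := by
  have := finrank_sup_add_finrank_inf_eq X' (X ⊓ Y)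
  rwa [← inf_assoc, inf_eq_left.2 hX] at this

end Submodule

/-! ### Classification of the orbits by matrices. -/

namespace ZeroSchur

variable {k : Type*} [Field k] {n r : ℕ}

/-- The dimension of `(V_i + V'_j) / V'_j` for a pair of flags. -/
noncomputable def gap (p : Flag k n r × Flag k n r) (i j : Fin (n + 1)) : ℤ :=
  Submodule.relDim (p.1.space i) (p.2.space j)

theorem relMatrix_apply (p : Flag k n r × Flag k n r) (i j : Fin n) :
    (relMatrix p i j : ℤ) = gap p i.succ j.castSucc - gap p i.succ j.succ
      - gap p i.castSucc j.castSucc + gap p i.castSucc j.succ := by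
  have hi := p.1.mono (Fin.castSucc_lt_succ (i := i)).le
  have hj := p.2.mono (Fin.castSucc_lt_succ (i := j)).le
  have h1 := Submodule.finrank_sup_inf_of_le (Y := p.2.space j.succ) hi
  have h2 := Submodule.finrank_sup_inf_of_le (Y := p.2.space j.castSucc) hi
  have h3 : finrank k ↥(p.1.space i.castSucc ⊔ p.1.space i.succ ⊓ p.2.space j.castSucc) ≤
      finrank k ↥(p.1.space i.castSucc ⊔ p.1.space i.succ ⊓ p.2.space j.succ) :=
    Submodule.finrank_mono (sup_le_sup_left (inf_le_inf_left _ hj) _)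
  simp only [relMatrix, Matrix.of_apply, gap, Submodule.relDim_eq_sub_inf]
  omega

theorem relMatrix_congr {p q : Flag k n r × Flag k n r} (h : gap p = gap q) :
    relMatrix p = relMatrix q := by
  ext i j
  have h1 := relMatrix_apply p i j
  rw [h, ← relMatrix_apply q i j] at h1
  exact_mod_cast h1

theorem finrank_smul_space (g : Matrix.GeneralLinearGroup (Fin r) k) (f : Flag k n r)
    (i : Fin (n + 1)) : finrank k ((g • f).space i) = finrank k (f.space i) :=
  (Submodule.equivMapOfInjective _ (mulVecLin_injective g) _).finrank_eq.symm

theorem gap_smul (g : Matrix.GeneralLinearGroup (Fin r) k) (p : Flag k n r × Flag k n r) :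
    gap (g • p) = gap p := by
  ext i j
  have h : finrank k ↥((g • p).1.space i ⊔ (g • p).2.space j) =
      finrank k ↥(p.1.space i ⊔ p.2.space j) := by
    rw [Prod.smul_fst, Prod.smul_snd, smul_space, smul_space, ← Submodule.map_sup]
    exact (Submodule.equivMapOfInjective _ (mulVecLin_injective g) _).finrank_eq.symm
  unfold gap Submodule.relDim
  rw [h, Prod.smul_snd, finrank_smul_space]

theorem gap_zero_left (p : Flag k n r × Flag k n r) (j : Fin (n + 1)) : gap p 0 j = 0 := by
  rw [gap, Submodule.relDim, p.1.space_zero, bot_sup_eq, sub_self]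

theorem gap_last_right (p : Flag k n r × Flag k n r) (i : Fin (n + 1)) :
    gap p i (Fin.last n) = 0 := by
  rw [gap, Submodule.relDim, p.2.space_last, sup_top_eq, sub_self]

theorem gap_last_zero (p : Flag k n r × Flag k n r) : gap p (Fin.last n) 0 = r := by
  rw [gap, Submodule.relDim, p.2.space_zero, p.1.space_last, sup_bot_eq]
  simp

theorem sum_sub_castSucc (F : Fin (n + 1) → ℤ) :
    ∑ i : Fin n, (F i.succ - F i.castSucc) = F (Fin.last n) - F 0 := by
  have h1 := Fin.sum_univ_succ F
  have h2 := Fin.sum_univ_castSucc F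
  rw [Finset.sum_sub_distrib]
  linarith

theorem sum_relMatrix (p : Flag k n r × Flag k n r) : ∑ i, ∑ j, relMatrix p i j = r := by
  have h : ∀ i : Fin n, ∑ j, (relMatrix p i j : ℤ) = gap p i.succ 0 - gap p i.castSucc 0 := by
    intro i
    have := sum_sub_castSucc fun j => gap p i.castSucc j - gap p i.succ j
    simp only [gap_last_right] at this
    rw [show gap p i.succ 0 - gap p i.castSucc 0 =
      0 - 0 - (gap p i.castSucc 0 - gap p i.succ 0) by ring, ← this]
    refine Finset.sum_congr rfl fun j _ => ?_
    rw [relMatrix_apply]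
    ring
  zify
  simp only [h]
  rw [sum_sub_castSucc fun i => gap p i 0, gap_last_zero, gap_zero_left]
  ring


/-- The space `V_i ∩ V'_j` for a pair of flags. -/
def meet (p : Flag k n r × Flag k n r) (i j : Fin (n + 1)) : Submodule k (Fin r → k) :=
  p.1.space i ⊓ p.2.space j

theorem meet_mono (p : Flag k n r × Flag k n r) {i i' j j' : Fin (n + 1)} (hi : i ≤ i')
    (hj : j ≤ j') : meet p i j ≤ meet p i' j' :=
  inf_le_inf (p.1.mono hi) (p.2.mono hj)

theorem relMatrix_eq_meet (p : Flag k n r × Flag k n r) (i j : Fin n) :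
    (relMatrix p i j : ℤ) = finrank k (meet p i.succ j.succ) - finrank k (meet p i.succ j.castSucc)
      - finrank k (meet p i.castSucc j.succ) + finrank k (meet p i.castSucc j.castSucc) := by
  rw [relMatrix_apply]
  simp only [gap, Submodule.relDim_eq_sub_inf]
  unfold meet
  ring

/-- C is a cell of the double filtration: it complements in V_i ∩ V'_j the part coming from smaller
indices. Cells supply the vectors of the adapted basis. -/
theorem exists_complement_meet (p : Flag k n r × Flag k n r) (i j : Fin n) :
    ∃ C : Submodule k (Fin r → k),
      meet p i.castSucc j.succ ⊔ meet p i.succ j.castSucc ⊔ C = meet p i.succ j.succ ∧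
      finrank k C = relMatrix p i j := by
  have hi := (Fin.castSucc_lt_succ (i := i)).le
  have hj := (Fin.castSucc_lt_succ (i := j)).le
  set E := meet p i.castSucc j.succ ⊔ meet p i.succ j.castSucc with hE
  have hED : E ≤ meet p i.succ j.succ :=
    sup_le (meet_mono p hi le_rfl) (meet_mono p le_rfl hj)
  obtain ⟨C', hC'⟩ := Submodule.exists_isCompl E
  have hsup : E ⊔ C' ⊓ meet p i.succ j.succ = meet p i.succ j.succ := by
    rw [← sup_inf_assoc_of_le C' hED, hC'.sup_eq_top, top_inf_eq]
  refine ⟨C' ⊓ meet p i.succ j.succ, hsup, ?_⟩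
  have hinf : E ⊓ (C' ⊓ meet p i.succ j.succ) = ⊥ := by
    rw [← inf_assoc, hC'.inf_eq_bot, bot_inf_eq]
  have h1 := Submodule.finrank_sup_add_finrank_inf_eq E (C' ⊓ meet p i.succ j.succ)
  rw [hsup, hinf, finrank_bot] at h1
  have h2 := Submodule.finrank_sup_add_finrank_inf_eq (meet p i.castSucc j.succ)
    (meet p i.succ j.castSucc)
  have h3 : meet p i.castSucc j.succ ⊓ meet p i.succ j.castSucc =
      meet p i.castSucc j.castSucc :=
    le_antisymm (inf_le_inf inf_le_left inf_le_right)
      (le_inf (meet_mono p le_rfl hj) (meet_mono p hi le_rfl))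
  rw [h3, ← hE] at h2
  have h4 := relMatrix_eq_meet p i j
  omega

/-- The index set of a basis adapted to a pair of flags with matrix `A`. -/
abbrev Cells (A : Matrix (Fin n) (Fin n) ℕ) : Type :=
  Σ c : Fin n × Fin n, Fin (A c.1 c.2)

theorem card_cells (A : Matrix (Fin n) (Fin n) ℕ) :
    Fintype.card (Cells A) = ∑ i, ∑ j, A i j := by
  simp [Cells, Fintype.sum_prod_type]

/-- Bases of all cells are put together. They span every V_i ∩ V'_j by double induction. -/
theorem exists_adapted_basis (p : Flag k n r × Flag k n r) :
    ∃ b : Basis (Cells (relMatrix p)) k (Fin r → k),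
      (∀ i, p.1.space i = Submodule.span k (b '' {x | x.1.1.castSucc < i})) ∧
      (∀ j, p.2.space j = Submodule.span k (b '' {x | x.1.2.castSucc < j})) := by
  choose C hC hCdim using exists_complement_meet p
  let v : Cells (relMatrix p) → Fin r → k := fun x =>
    (finBasisOfFinrankEq k (C x.1.1 x.1.2) (hCdim x.1.1 x.1.2) x.2 : Fin r → k)
  have hspan : ∀ i j, C i j ≤ Submodule.span k (v '' {x | x.1 = (i, j)}) := by
    intro i j
    have h := (finBasisOfFinrankEq k (C i j) (hCdim i j)).span_eq
    have h2 := congrArg (Submodule.map (C i j).subtype) h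
    rw [Submodule.map_span, Submodule.map_top, Submodule.range_subtype] at h2
    rw [← h2]
    refine Submodule.span_mono ?_
    rintro _ ⟨_, ⟨s, rfl⟩, rfl⟩
    exact ⟨⟨(i, j), s⟩, rfl, rfl⟩
  have hmem : ∀ x, v x ∈ meet p x.1.1.succ x.1.2.succ := fun x => by
    rw [← hC]
    exact Submodule.mem_sup_right (Subtype.property _)
  have hle : ∀ i j, meet p i j ≤
      Submodule.span k (v '' {x | x.1.1.castSucc < i ∧ x.1.2.castSucc < j}) := by
    intro i
    induction i using Fin.induction with
    | zero => intro j; simp [meet, p.1.space_zero]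
    | succ i ihi =>
      intro j
      induction j using Fin.induction with
      | zero => simp [meet, p.2.space_zero]
      | succ j ihj =>
        rw [← hC]
        refine sup_le (sup_le ((ihi _).trans ?_) (ihj.trans ?_)) ((hspan i j).trans ?_)
        · refine Submodule.span_mono (Set.image_mono ?_)
          rintro x ⟨h1, h2⟩
          exact ⟨h1.trans Fin.castSucc_lt_succ, h2⟩
        · refine Submodule.span_mono (Set.image_mono ?_)
          rintro x ⟨h1, h2⟩
          exact ⟨h1, h2.trans Fin.castSucc_lt_succ⟩
        · refine Submodule.span_mono (Set.image_mono ?_)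
          rintro x (hx : x.1 = _)
          simp [hx]
  have htop : ⊤ ≤ Submodule.span k (Set.range v) := by
    have := hle (Fin.last n) (Fin.last n)
    rw [meet, p.1.space_last, p.2.space_last, inf_top_eq] at this
    exact this.trans (Submodule.span_mono (Set.image_subset_range _ _))
  -- A spanning family of V with exactly r members, the sum of the entries of the matrix, is
  -- independent.
  have hli : LinearIndependent k v := by
    refine linearIndependent_of_top_le_span_of_card_eq_finrank htop ?_
    rw [card_cells, sum_relMatrix]
    simp
  refine ⟨Basis.mk hli htop, fun i => ?_, fun j => ?_⟩
  · rw [Basis.coe_mk]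
    refine le_antisymm ?_ (Submodule.span_le.2 ?_)
    · have := hle i (Fin.last n)
      rw [meet, p.2.space_last, inf_top_eq] at this
      exact this.trans (Submodule.span_mono (Set.image_mono fun x hx => hx.1))
    · rintro _ ⟨x, hx, rfl⟩
      exact p.1.mono (Fin.castSucc_lt_iff_succ_le.1 hx) (hmem x).1
  · rw [Basis.coe_mk]
    refine le_antisymm ?_ (Submodule.span_le.2 ?_)
    · have := hle (Fin.last n) j
      rw [meet, p.1.space_last, top_inf_eq] at this
      exact this.trans (Submodule.span_mono (Set.image_mono fun x hx => hx.2))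
    · rintro _ ⟨x, hx, rfl⟩
      exact p.2.mono (Fin.castSucc_lt_iff_succ_le.1 hx) (hmem x).2

/-- The element of `GL(V)` given by a linear automorphism of `k^r`. -/
noncomputable def glOfEquiv (e : (Fin r → k) ≃ₗ[k] (Fin r → k)) :
    Matrix.GeneralLinearGroup (Fin r) k where
  val := LinearMap.toMatrix' (e : (Fin r → k) →ₗ[k] (Fin r → k))
  inv := LinearMap.toMatrix' (e.symm : (Fin r → k) →ₗ[k] (Fin r → k))
  val_inv := by rw [← LinearMap.toMatrix'_comp]; simp
  inv_val := by rw [← LinearMap.toMatrix'_comp]; simp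

theorem mulVecLin_glOfEquiv (e : (Fin r → k) ≃ₗ[k] (Fin r → k)) :
    Matrix.mulVecLin (glOfEquiv e).val = (e : (Fin r → k) →ₗ[k] (Fin r → k)) := by
  rw [← Matrix.toLin'_apply', glOfEquiv, Matrix.toLin'_toMatrix']

/-- Equal matrices give adapted bases with the same index set; the automorphism matching the two
bases carries one pair of flags to the other. -/
theorem exists_smul_eq_of_relMatrix_eq {p q : Flag k n r × Flag k n r}
    (h : relMatrix p = relMatrix q) : ∃ g : Matrix.GeneralLinearGroup (Fin r) k, g • p = q := by
  obtain ⟨b, hb1, hb2⟩ := exists_adapted_basis p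
  have hq := exists_adapted_basis q
  rw [← h] at hq
  obtain ⟨c, hc1, hc2⟩ := hq
  have key : ∀ s, (Submodule.span k (b '' s)).map
      (Matrix.mulVecLin (glOfEquiv (b.equiv c (Equiv.refl _))).val) =
      Submodule.span k (c '' s) := by
    intro s
    rw [mulVecLin_glOfEquiv, Submodule.map_span, ← Set.image_comp]
    congr 1
    refine Set.image_congr fun x _ => ?_
    simp
  refine ⟨glOfEquiv (b.equiv c (Equiv.refl _)), Prod.ext ?_ ?_⟩
  · ext1
    funext i
    rw [Prod.smul_fst, smul_space, hb1, hc1, key]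
  · ext1
    funext i
    rw [Prod.smul_snd, smul_space, hb2, hc2, key]

theorem Orbit.matrix_mk (p : Flag k n r × Flag k n r) :
    Orbit.matrix (Quotient.mk _ p : Orbit k n r) = relMatrix p := rfl

theorem Orbit.matrix_injective : Function.Injective (Orbit.matrix (k := k) (n := n) (r := r)) := by
  intro O O' h
  induction O using Quotient.inductionOn with | _ p
  induction O' using Quotient.inductionOn with | _ q
  obtain ⟨g, rfl⟩ := exists_smul_eq_of_relMatrix_eq h
  exact Quotient.sound ((MulAction.orbitRel _ _).symm ⟨g, rfl⟩)

theorem span_image_inf {ι M : Type*} [AddCommGroup M] [Module k M] (b : Basis ι k M)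
    (s t : Set ι) : Submodule.span k (b '' s) ⊓ Submodule.span k (b '' t) =
      Submodule.span k (b '' (s ∩ t)) := by
  ext m
  simp only [Submodule.mem_inf, Basis.mem_span_image, Set.subset_inter_iff]

theorem finrank_span_image {ι M : Type*} [Fintype ι] [AddCommGroup M] [Module k M]
    (b : Basis ι k M) (P : ι → Prop) [DecidablePred P] :
    (finrank k ↥(Submodule.span k (b '' {x | P x})) : ℤ) = ∑ x, if P x then 1 else 0 := by
  have h : b '' {x | P x} = Set.range fun x : {x // P x} => b x := by
    ext; simp
  have h2 : LinearIndependent k fun x : {x // P x} => b x :=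
    b.linearIndependent.comp _ Subtype.val_injective
  rw [h, finrank_span_eq_card h2, Fintype.card_subtype]
  simp

/-- The flag spanned by initial parts of a basis that is graded by `Fin n`. -/
noncomputable def flagOfBasis {ι : Type*} (b : Basis ι k (Fin r → k)) (c : ι → Fin n) :
    Flag k n r where
  space i := Submodule.span k (b '' {x | (c x).castSucc < i})
  mono i j h := Submodule.span_mono (Set.image_mono fun _ hx => lt_of_lt_of_le hx h)
  space_zero := by simp
  space_last := by simp [Fin.castSucc_lt_last]

theorem finrank_meet_flagOfBasis {ι : Type*} [Fintype ι] (b : Basis ι k (Fin r → k))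
    (c d : ι → Fin n) (i j : Fin (n + 1)) :
    (finrank k (meet (flagOfBasis b c, flagOfBasis b d) i j) : ℤ) =
      ∑ x, (if (c x).castSucc < i then 1 else 0) * (if (d x).castSucc < j then 1 else 0) := by
  have h : meet (flagOfBasis b c, flagOfBasis b d) i j =
      Submodule.span k (b '' {x | (c x).castSucc < i ∧ (d x).castSucc < j}) :=
    span_image_inf b _ _
  rw [h]
  have := finrank_span_image b fun x => (c x).castSucc < i ∧ (d x).castSucc < j
  refine this.trans (Finset.sum_congr rfl fun x _ => ?_)
  split_ifs <;> simp_all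

theorem indicator_succ_sub (a i : Fin n) :
    ((if a.castSucc < i.succ then 1 else 0) - if a.castSucc < i.castSucc then 1 else 0 : ℤ) =
      if a = i then 1 else 0 := by
  simp only [Fin.lt_def, Fin.ext_iff, Fin.val_castSucc, Fin.val_succ]
  split_ifs <;> omega

theorem relMatrix_flagOfBasis (A : Matrix (Fin n) (Fin n) ℕ) (b : Basis (Cells A) k (Fin r → k)) :
    relMatrix (flagOfBasis b fun x => x.1.1, flagOfBasis b fun x => x.1.2) = A := by
  ext i j
  have h := relMatrix_eq_meet (flagOfBasis b fun x => x.1.1, flagOfBasis b fun x => x.1.2) i j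
  simp only [finrank_meet_flagOfBasis, ← Finset.sum_sub_distrib, ← Finset.sum_add_distrib] at h
  have h2 : ∀ x : Cells A, (if x.1 = (i, j) then 1 else 0 : ℤ) =
      (if x.1.1 = i then 1 else 0) * (if x.1.2 = j then 1 else 0) := fun x => by
    obtain ⟨⟨a, c⟩, s⟩ := x
    simp only [Prod.mk.injEq, ite_and]
    split_ifs <;> simp
  have h3 : ∑ x : Cells A, (if x.1 = (i, j) then 1 else 0 : ℤ) = A i j := by
    rw [Fintype.sum_sigma, Finset.sum_eq_single (i, j)]
    · simp
    · intro c _ hc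
      simp [hc]
    · simp
  simp only [h2, ← indicator_succ_sub] at h3
  zify
  rw [h, ← h3]
  refine Finset.sum_congr rfl fun x _ => ?_
  ring

theorem Orbit.sum_matrix (O : Orbit k n r) : ∑ i, ∑ j, O.matrix i j = r := by
  induction O using Quotient.inductionOn with | _ p
  exact sum_relMatrix p

theorem exists_orbit_matrix_eq (A : Matrix (Fin n) (Fin n) ℕ) (hA : ∑ i, ∑ j, A i j = r) :
    ∃ O : Orbit k n r, O.matrix = A := by
  have e : Fin r ≃ Cells A := Fintype.equivOfCardEq (by rw [card_cells, hA, Fintype.card_fin])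
  exact ⟨Quotient.mk _ _, relMatrix_flagOfBasis A ((Pi.basisFun k (Fin r)).reindex e)⟩

end ZeroSchur

/-! ### Lower semicontinuity of dimensions of moving subspaces. -/

section Semicontinuity

variable {k : Type*} [Field k] {r : ℕ}

theorem LinearIndependent.exists_mul_eq_one {m : ℕ} {A : Matrix (Fin m) (Fin r) k}
    (hA : LinearIndependent k A.row) : ∃ B : Matrix (Fin r) (Fin m) k, A * B = 1 := by
  have hinj : Function.Injective A.vecMulLinear := Matrix.vecMul_injective_iff.2 hA
  obtain ⟨L, hL⟩ := A.vecMulLinear.exists_leftInverse_of_injective (LinearMap.ker_eq_bot.2 hinj)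
  refine ⟨(LinearMap.toMatrix' L)ᵀ, ?_⟩
  apply Matrix.transpose_injective
  rw [Matrix.transpose_mul, Matrix.transpose_transpose, Matrix.transpose_one,
    ← LinearMap.toMatrix'_id, ← hL, LinearMap.toMatrix'_comp]
  congr 1
  ext i j
  simp [LinearMap.toMatrix'_apply]

/-- Linear independence of the rows of a matrix is an open condition on the entries. -/
theorem exists_generic_linearIndependent {S : Type*} [CommRing S] [Algebra k S] {m : ℕ}
    (A : Matrix (Fin m) (Fin r) S) (φ₀ : S →ₐ[k] k)
    (h : LinearIndependent k (A.map φ₀).row) :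
    ∃ D : S, φ₀ D ≠ 0 ∧ ∀ φ : S →ₐ[k] k, φ D ≠ 0 → LinearIndependent k (A.map φ).row := by
  -- B is a constant right inverse of the matrix at `φ₀`. The witness D = det (A B) equals 1 there,
  -- and wherever D is nonzero the rows of A are independent.
  obtain ⟨B, hB⟩ := h.exists_mul_eq_one
  have key : ∀ φ : S →ₐ[k] k, φ (A * B.map (algebraMap k S)).det = (A.map φ * B).det := by
    intro φ
    rw [AlgHom.map_det, AlgHom.mapMatrix_apply, Matrix.map_mul, Matrix.map_map]
    congr 2
    ext i j
    simp
  refine ⟨(A * B.map (algebraMap k S)).det, by rw [key, hB]; simp, fun φ hφ => ?_⟩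
  rw [key] at hφ
  have hu : IsUnit (A.map φ * B) := (Matrix.isUnit_iff_isUnit_det _).2 hφ.isUnit
  rw [← Matrix.vecMul_injective_iff]
  intro v w hvw
  refine Matrix.vecMul_injective_iff_isUnit.2 hu ?_
  dsimp only at hvw ⊢
  rw [← Matrix.vecMul_vecMul, ← Matrix.vecMul_vecMul, hvw]

theorem Submodule.exists_linearIndependent_fin_finrank {V : Type*} [AddCommGroup V] [Module k V]
    [FiniteDimensional k V] (W : Submodule k V) :
    ∃ u : Fin (finrank k W) → V, LinearIndependent k u ∧ ∀ s, u s ∈ W :=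
  ⟨fun s => finBasis k W s, (finBasis k W).linearIndependent.map' W.subtype W.ker_subtype,
    fun s => (finBasis k W s).2⟩

/-- The dimension of a sum of two moving subspaces does not drop at a generic point. -/
theorem exists_generic_finrank_sup {S : Type*} [CommRing S] [Algebra k S]
    (M N : Matrix (Fin r) (Fin r) S) (X Y : Submodule k (Fin r → k)) (φ₀ : S →ₐ[k] k) :
    ∃ D : S, φ₀ D ≠ 0 ∧ ∀ φ : S →ₐ[k] k, φ D ≠ 0 →
      finrank k ↥(X.map (M.map φ₀).mulVecLin ⊔ Y.map (N.map φ₀).mulVecLin) ≤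
        finrank k ↥(X.map (M.map φ).mulVecLin ⊔ Y.map (N.map φ).mulVecLin) := by
  -- A basis u of the sum at `φ₀` is written as Mv + Nw with constant v in X and w in Y; the same v
  -- and w give moving vectors that stay independent generically.
  obtain ⟨u, hu, hmem⟩ := Submodule.exists_linearIndependent_fin_finrank
    (X.map (M.map φ₀).mulVecLin ⊔ Y.map (N.map φ₀).mulVecLin)
  have hb : ∀ s, ∃ v ∈ X, ∃ w ∈ Y,
      (M.map φ₀).mulVec v + (N.map φ₀).mulVec w = u s := fun s => by
    obtain ⟨_, ⟨v, hv, rfl⟩, _, ⟨w, hw, rfl⟩, h⟩ := Submodule.mem_sup.1 (hmem s)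
    exact ⟨v, hv, w, hw, h⟩
  choose v hv w hw hvw using hb
  let A : Matrix (Fin _) (Fin r) S := Matrix.of fun s =>
    M.mulVec (fun c => algebraMap k S (v s c)) + N.mulVec (fun c => algebraMap k S (w s c))
  have hA : ∀ φ : S →ₐ[k] k, (A.map φ).row =
      fun s => (M.map φ).mulVec (v s) + (N.map φ).mulVec (w s) := by
    intro φ
    ext s c
    simp [A, Matrix.row, Matrix.mulVec, dotProduct]
  have h0 : LinearIndependent k (A.map φ₀).row := by
    rw [hA, funext hvw]
    exact hu
  obtain ⟨D, hD0, hD⟩ := exists_generic_linearIndependent A φ₀ h0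
  refine ⟨D, hD0, fun φ hφ => ?_⟩
  have hli := hD φ hφ
  rw [hA] at hli
  have := finrank_span_eq_card hli
  rw [Fintype.card_fin] at this
  rw [← this]
  refine Submodule.finrank_mono (Submodule.span_le.2 ?_)
  rintro _ ⟨s, rfl⟩
  exact Submodule.add_mem_sup ⟨v s, hv s, rfl⟩ ⟨w s, hw s, rfl⟩

end Semicontinuity

theorem Polynomial.exists_eval_ne_zero_of_infinite {k : Type*} [Field k] [Infinite k]
    {P : Polynomial k} (hP : P ≠ 0) : ∃ t, P.eval t ≠ 0 := by
  by_contra! h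
  exact hP (Polynomial.funext (by simpa using h))

/-! ### The Zariski topology on pairs of flags and irreducibility of the composites. -/

namespace ZeroSchur

variable {k : Type*} [Field k] {n r : ℕ}

/-- The generating sets are a base, because the product of two polynomials cuts out the
intersection. -/
theorem exists_basicOpen_of_isOpen_zariski {σ : Type} {U : Set (σ → k)}
    (hU : IsOpen[zariski k σ] U) {x : σ → k} (hx : x ∈ U) :
    ∃ F : MvPolynomial σ k, MvPolynomial.eval x F ≠ 0 ∧
      ∀ y, MvPolynomial.eval y F ≠ 0 → y ∈ U := by
  induction hU with
  | basic s hs =>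
    obtain ⟨F, rfl⟩ := hs
    exact ⟨F, hx, fun _ hy => hy⟩
  | univ => exact ⟨1, by simp, fun _ _ => trivial⟩
  | inter s t _ _ ihs iht =>
    obtain ⟨F, hF, hF'⟩ := ihs hx.1
    obtain ⟨G, hG, hG'⟩ := iht hx.2
    refine ⟨F * G, by simp [hF, hG], fun y hy => ?_⟩
    rw [map_mul] at hy
    exact ⟨hF' y (left_ne_zero_of_mul hy), hG' y (right_ne_zero_of_mul hy)⟩
  | sUnion S _ ih =>
    obtain ⟨s, hs, hxs⟩ := hx
    obtain ⟨F, hF, hF'⟩ := ih s hs hxs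
    exact ⟨F, hF, fun y hy => ⟨s, hs, hF' y hy⟩⟩

theorem isOpen_zariski_basicOpen {σ : Type} (F : MvPolynomial σ k) :
    IsOpen[zariski k σ] {x | MvPolynomial.eval x F ≠ 0} :=
  TopologicalSpace.isOpen_generateFrom_of_mem ⟨F, rfl⟩

/-- The coordinates of a pair of matrices in any commutative ring. -/
def pairCoords {S : Type*} (M N : Matrix (Fin r) (Fin r) S) :
    (Fin r × Fin r) ⊕ (Fin r × Fin r) → S :=
  Sum.elim (fun e => M e.1 e.2) (fun e => N e.1 e.2)

theorem exists_basicOpen_of_isOpen_zariskiFlags {U : Set (Flag k n r × Flag k n r)}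
    (hU : IsOpen[zariskiFlags k n r] U) (p : Flag k n r × Flag k n r)
    (x y : Matrix.GeneralLinearGroup (Fin r) k) (hxy : (x • p.1, y • p.2) ∈ U) :
    ∃ F : MvPolynomial ((Fin r × Fin r) ⊕ (Fin r × Fin r)) k,
      MvPolynomial.eval (pairCoords x.val y.val) F ≠ 0 ∧
      ∀ x' y' : Matrix.GeneralLinearGroup (Fin r) k,
        MvPolynomial.eval (pairCoords x'.val y'.val) F ≠ 0 → (x' • p.1, y' • p.2) ∈ U := by
  have h := isOpen_coinduced.1 (isOpen_iSup_iff.1 hU p)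
  obtain ⟨T, hT, hTU⟩ := (@isOpen_induced_iff _ _ (zariski k _) _ _).1 h
  have hx : pairCoords x.val y.val ∈ T := by
    have : (x, y) ∈ (fun g : Matrix.GeneralLinearGroup (Fin r) k ×
      Matrix.GeneralLinearGroup (Fin r) k => (g.1 • p.1, g.2 • p.2)) ⁻¹' U := hxy
    rw [← hTU] at this
    exact this
  obtain ⟨F, hF, hF'⟩ := exists_basicOpen_of_isOpen_zariski hT hx
  refine ⟨F, hF, fun x' y' h' => ?_⟩
  have : (x', y') ∈ (fun g : Matrix.GeneralLinearGroup (Fin r) k ×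
      Matrix.GeneralLinearGroup (Fin r) k => (g.1 • p.1, g.2 • p.2)) ⁻¹' U := by
    rw [← hTU]
    exact hF' _ h'
  exact this

theorem isOpen_zariskiFlags_of_basicOpen {U : Set (Flag k n r × Flag k n r)}
    (h : ∀ (p : Flag k n r × Flag k n r) (x y : Matrix.GeneralLinearGroup (Fin r) k),
      (x • p.1, y • p.2) ∈ U → ∃ F : MvPolynomial ((Fin r × Fin r) ⊕ (Fin r × Fin r)) k,
      MvPolynomial.eval (pairCoords x.val y.val) F ≠ 0 ∧
      ∀ x' y' : Matrix.GeneralLinearGroup (Fin r) k,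
        MvPolynomial.eval (pairCoords x'.val y'.val) F ≠ 0 → (x' • p.1, y' • p.2) ∈ U) :
    IsOpen[zariskiFlags k n r] U := by
  refine isOpen_iSup_iff.2 fun p => isOpen_coinduced.2 ?_
  let := zariskiGL k r
  refine isOpen_iff_forall_mem_open.2 fun g hg => ?_
  obtain ⟨F, hF, hF'⟩ := h p g.1 g.2 hg
  exact ⟨_, fun g' hg' => hF' g'.1 g'.2 hg',
    (@isOpen_induced_iff _ _ (zariski k _) _ _).2 ⟨_, isOpen_zariski_basicOpen F, rfl⟩, hF⟩

/-- The dimension of `V_i + V'_j` is lower semicontinuous. -/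
theorem isOpen_le_finrank_sup (i j : Fin (n + 1)) (m : ℕ) :
    IsOpen[zariskiFlags k n r] {p : Flag k n r × Flag k n r |
      m ≤ finrank k ↥(p.1.space i ⊔ p.2.space j)} := by
  refine isOpen_zariskiFlags_of_basicOpen fun p x y hxy => ?_
  let M : Matrix (Fin r) (Fin r) (MvPolynomial ((Fin r × Fin r) ⊕ (Fin r × Fin r)) k) :=
    Matrix.of fun a b => MvPolynomial.X (Sum.inl (a, b))
  let N : Matrix (Fin r) (Fin r) (MvPolynomial ((Fin r × Fin r) ⊕ (Fin r × Fin r)) k) :=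
    Matrix.of fun a b => MvPolynomial.X (Sum.inr (a, b))
  have hM : ∀ A B : Matrix (Fin r) (Fin r) k,
      M.map (MvPolynomial.aeval (pairCoords A B) : _ →ₐ[k] k) = A := fun A B => by
    ext; simp [M, pairCoords]
  have hN : ∀ A B : Matrix (Fin r) (Fin r) k,
      N.map (MvPolynomial.aeval (pairCoords A B) : _ →ₐ[k] k) = B := fun A B => by
    ext; simp [N, pairCoords]
  obtain ⟨D, hD, hD'⟩ := exists_generic_finrank_sup M N (p.1.space i) (p.2.space j)
    (MvPolynomial.aeval (pairCoords x.val y.val) : _ →ₐ[k] k)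
  refine ⟨D, by simpa [MvPolynomial.aeval_eq_eval] using hD, fun x' y' h' => ?_⟩
  have := hD' (MvPolynomial.aeval (pairCoords x'.val y'.val) : _ →ₐ[k] k)
    (by simpa [MvPolynomial.aeval_eq_eval] using h')
  rw [hM, hN, hM, hN] at this
  exact le_trans hxy this

theorem smul_eq_self_of_map_le (g : Matrix.GeneralLinearGroup (Fin r) k) (f : Flag k n r)
    (h : ∀ i, ∀ v ∈ f.space i, g.val.mulVec v ∈ f.space i) : g • f = f := by
  ext1
  funext i
  refine Submodule.eq_of_le_of_finrank_eq ?_ (finrank_smul_space g f i)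
  rw [smul_space, Submodule.map_le_iff_le_comap]
  exact h i

theorem mulVec_mem_of_smul_eq_self {g : Matrix.GeneralLinearGroup (Fin r) k} {f : Flag k n r}
    (h : g • f = f) {i : Fin (n + 1)} {v : Fin r → k} (hv : v ∈ f.space i) :
    g.val.mulVec v ∈ f.space i := by
  rw [← h, smul_space]
  exact ⟨v, hv, rfl⟩

theorem mem_orbit_iff {p : Flag k n r × Flag k n r} {O : Orbit k n r} :
    p ∈ O.orbit ↔ (Quotient.mk _ p : Orbit k n r) = O :=
  MulAction.orbitRel.Quotient.mem_orbit

theorem exists_smul_eq_of_mem_orbit {p q : Flag k n r × Flag k n r} {O : Orbit k n r}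
    (hp : p ∈ O.orbit) (hq : q ∈ O.orbit) :
    ∃ g : Matrix.GeneralLinearGroup (Fin r) k, g • p = q := by
  rw [mem_orbit_iff] at hp hq
  exact Quotient.exact (hq.trans hp.symm)

theorem smul_mem_orbit {p : Flag k n r × Flag k n r} {O : Orbit k n r} (hp : p ∈ O.orbit)
    (g : Matrix.GeneralLinearGroup (Fin r) k) : g • p ∈ O.orbit := by
  rw [mem_orbit_iff] at hp ⊢
  rw [← hp]
  exact Quotient.sound ⟨g, rfl⟩

/-- The segment from the identity to a matrix, as a matrix over the polynomial ring. -/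
noncomputable def segment (A : Matrix (Fin r) (Fin r) k) :
    Matrix (Fin r) (Fin r) (Polynomial k) :=
  1 + (Polynomial.X : Polynomial k) • (A - 1).map Polynomial.C

theorem segment_map (A : Matrix (Fin r) (Fin r) k) (t : k) :
    (segment A).map (Polynomial.aeval t : _ →ₐ[k] k) = 1 + t • (A - 1) := by
  ext i j
  by_cases h : i = j
  · simp [segment, h]
  · simp [segment, h, mul_comm t]

theorem eval_det_segment (A : Matrix (Fin r) (Fin r) k) (t : k) :
    (segment A).det.eval t = (1 + t • (A - 1)).det := by
  rw [← segment_map, ← Polynomial.coe_aeval_eq_eval]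
  exact AlgHom.map_det (Polynomial.aeval t) (segment A)

/-- Two open sets that meet the set of composites of two orbits have a common point in it. -/
theorem composites_irreducible [Infinite k] {O₁ O₂ : Orbit k n r}
    {U₁ U₂ : Set (Flag k n r × Flag k n r)}
    (hU₁ : IsOpen[zariskiFlags k n r] U₁) (hU₂ : IsOpen[zariskiFlags k n r] U₂)
    {p₁ p₂ : Flag k n r × Flag k n r} (hp₁ : p₁ ∈ composites O₁ O₂) (hp₂ : p₂ ∈ composites O₁ O₂)
    (h₁ : p₁ ∈ U₁) (h₂ : p₂ ∈ U₂) : ∃ p ∈ composites O₁ O₂, p ∈ U₁ ∧ p ∈ U₂ := by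
  obtain ⟨g₁, ha₁, hb₁⟩ := hp₁
  obtain ⟨g₂, ha₂, hb₂⟩ := hp₂
  obtain ⟨x, hx⟩ := exists_smul_eq_of_mem_orbit ha₁ ha₂
  obtain ⟨y, hy⟩ := exists_smul_eq_of_mem_orbit hb₁ hb₂
  have hx1 : x • p₁.1 = p₂.1 := congrArg Prod.fst hx
  have hx2 : x • g₁ = g₂ := congrArg Prod.snd hx
  have hy1 : y • g₁ = g₂ := congrArg Prod.fst hy
  have hy2 : y • p₁.2 = p₂.2 := congrArg Prod.snd hy
  have hstab : (x⁻¹ * y) • g₁ = g₁ := by rw [mul_smul, hy1, ← hx2, inv_smul_smul]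
  obtain ⟨F₁, hF₁, hF₁'⟩ := exists_basicOpen_of_isOpen_zariskiFlags hU₁ p₁ 1 1 (by simpa using h₁)
  obtain ⟨F₂, hF₂, hF₂'⟩ := exists_basicOpen_of_isOpen_zariskiFlags hU₂ p₁ x y
    (by rw [hx1, hy2]; exact h₂)
  -- The curve t ↦ (M(t), M(t) N(t)) runs from (1, 1) at t = 0 to (x, y) at t = 1, so it leads from
  -- p₁ to p₂. Each open condition is a nonzero polynomial in t, and a common nonroot gives the
  -- required point.
  let M := segment x.val
  let N := segment (x⁻¹ * y).val
  have hcoords : ∀ (F : MvPolynomial ((Fin r × Fin r) ⊕ (Fin r × Fin r)) k) (t : k),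
      (MvPolynomial.aeval (pairCoords M (M * N)) F).eval t = MvPolynomial.eval
        (pairCoords (1 + t • (x.val - 1))
          ((1 + t • (x.val - 1)) * (1 + t • ((x⁻¹ * y).val - 1)))) F := by
    intro F t
    rw [← segment_map, ← segment_map, ← Matrix.map_mul, ← Polynomial.coe_aeval_eq_eval,
      ← MvPolynomial.aeval_eq_eval]
    change (Polynomial.aeval t : _ →ₐ[k] k) _ = _
    rw [← AlgHom.comp_apply, MvPolynomial.comp_aeval]
    congr 2
    funext e
    rcases e with e | e <;> rfl
  set G₁ := MvPolynomial.aeval (pairCoords M (M * N)) F₁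
  set G₂ := MvPolynomial.aeval (pairCoords M (M * N)) F₂
  have hG₁ : G₁ ≠ 0 := fun h0 => by
    have := hcoords F₁ 0
    rw [show MvPolynomial.aeval (pairCoords M (M * N)) F₁ = 0 from h0] at this
    refine hF₁ ?_
    simpa using this.symm
  have hG₂ : G₂ ≠ 0 := fun h0 => by
    have := hcoords F₂ 1
    rw [show MvPolynomial.aeval (pairCoords M (M * N)) F₂ = 0 from h0] at this
    refine hF₂ ?_
    rw [one_smul, one_smul, add_sub_cancel, add_sub_cancel, ← Units.val_mul,
      mul_inv_cancel_left] at this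
    simpa using this.symm
  have hdet : ∀ A : Matrix (Fin r) (Fin r) k, (segment A).det ≠ 0 := fun A h0 => by
    have := eval_det_segment A 0
    simp [h0] at this
  obtain ⟨t, ht⟩ := Polynomial.exists_eval_ne_zero_of_infinite
    (mul_ne_zero (mul_ne_zero hG₁ hG₂) (mul_ne_zero (hdet x.val) (hdet (x⁻¹ * y).val)))
  simp only [Polynomial.eval_mul, mul_ne_zero_iff, eval_det_segment] at ht
  obtain ⟨⟨ht₁, ht₂⟩, htx, hty⟩ := ht
  let X : Matrix.GeneralLinearGroup (Fin r) k := Matrix.GeneralLinearGroup.mkOfDetNeZero _ htx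
  let Y : Matrix.GeneralLinearGroup (Fin r) k := Matrix.GeneralLinearGroup.mkOfDetNeZero _ hty
  have hXv : X.val = 1 + t • (x.val - 1) := rfl
  have hYv : Y.val = 1 + t • ((x⁻¹ * y).val - 1) := rfl
  -- N(t) is an affine combination of 1 and x⁻¹y, which both preserve g₁. So g₁ moved by M(t)
  -- remains a middle flag along the curve.
  have hY : Y • g₁ = g₁ := by
    refine smul_eq_self_of_map_le Y g₁ fun i v hv => ?_
    rw [hYv, Matrix.add_mulVec, Matrix.smul_mulVec, Matrix.sub_mulVec, Matrix.one_mulVec]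
    exact add_mem hv (Submodule.smul_mem _ _ (sub_mem (mulVec_mem_of_smul_eq_self hstab hv) hv))
  refine ⟨(X • p₁.1, (X * Y) • p₁.2), ⟨X • g₁, smul_mem_orbit ha₁ X, ?_⟩, ?_, ?_⟩
  · have := smul_mem_orbit hb₁ (X * Y)
    rwa [Prod.smul_mk, mul_smul X Y g₁, hY] at this
  · refine hF₁' _ _ ?_
    rw [Units.val_mul, hXv, hYv, ← hcoords]
    exact ht₁
  · refine hF₂' _ _ ?_
    rw [Units.val_mul, hXv, hYv, ← hcoords]
    exact ht₂


/-! ### Open orbits are those with maximal gaps. -/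

theorem gap_eq_of_mem_orbit {p q : Flag k n r × Flag k n r} {O : Orbit k n r}
    (hp : p ∈ O.orbit) (hq : q ∈ O.orbit) : gap p = gap q := by
  obtain ⟨g, rfl⟩ := exists_smul_eq_of_mem_orbit hp hq
  exact (gap_smul g p).symm

theorem relMatrix_of_mem_orbit {p : Flag k n r × Flag k n r} {O : Orbit k n r}
    (hp : p ∈ O.orbit) : relMatrix p = O.matrix := by
  rw [mem_orbit_iff] at hp
  rw [← hp, Orbit.matrix_mk]

theorem mem_orbit_of_gap_eq {p q : Flag k n r × Flag k n r} {O : Orbit k n r}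
    (hp : p ∈ O.orbit) (h : gap p = gap q) : q ∈ O.orbit := by
  obtain ⟨g, rfl⟩ := exists_smul_eq_of_relMatrix_eq (relMatrix_congr h)
  exact smul_mem_orbit hp g

theorem smul_mem_composites {p : Flag k n r × Flag k n r} {O₁ O₂ : Orbit k n r}
    (hp : p ∈ composites O₁ O₂) (x : Matrix.GeneralLinearGroup (Fin r) k) :
    x • p ∈ composites O₁ O₂ := by
  obtain ⟨g, h₁, h₂⟩ := hp
  exact ⟨x • g, smul_mem_orbit h₁ x, smul_mem_orbit h₂ x⟩

theorem finrank_snd_eq_of_mem_composites {p q : Flag k n r × Flag k n r} {O₁ O₂ : Orbit k n r}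
    (hp : p ∈ composites O₁ O₂) (hq : q ∈ composites O₁ O₂) (j : Fin (n + 1)) :
    finrank k (p.2.space j) = finrank k (q.2.space j) := by
  obtain ⟨g, _, hg⟩ := hp
  obtain ⟨g', _, hg'⟩ := hq
  obtain ⟨x, hx⟩ := exists_smul_eq_of_mem_orbit hg hg'
  rw [← show x • p.2 = q.2 from congrArg Prod.snd hx, finrank_smul_space]

theorem IsOpenOrbitIn.exists_mem {O : Orbit k n r} {Z : Set (Flag k n r × Flag k n r)}
    (hO : IsOpenOrbitIn O Z) : ∃ q, q ∈ O.orbit ∧ q ∈ Z := by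
  obtain ⟨U, _, hU⟩ := hO
  induction O using Quotient.inductionOn with | _ q
  have hq : q ∈ MulAction.orbitRel.Quotient.orbit (Quotient.mk _ q : Orbit k n r) :=
    mem_orbit_iff.2 rfl
  refine ⟨q, hq, ?_⟩
  rw [← hU] at hq
  exact hq.2

theorem gap_le_iff_finrank_sup_le {p q : Flag k n r × Flag k n r} {O₁ O₂ : Orbit k n r}
    (hp : p ∈ composites O₁ O₂) (hq : q ∈ composites O₁ O₂) (i j : Fin (n + 1)) :
    gap p i j ≤ gap q i j ↔ finrank k ↥(p.1.space i ⊔ p.2.space j) ≤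
      finrank k ↥(q.1.space i ⊔ q.2.space j) := by
  have := finrank_snd_eq_of_mem_composites hp hq j
  unfold gap Submodule.relDim
  omega

/-- The open orbit among the composites of two orbits has the most generic relative position. -/
theorem IsOpenOrbitIn.gap_le [Infinite k] {O O₁ O₂ : Orbit k n r}
    (hO : IsOpenOrbitIn O (composites O₁ O₂)) {p q : Flag k n r × Flag k n r}
    (hq : q ∈ O.orbit) (hp : p ∈ composites O₁ O₂) (i j : Fin (n + 1)) :
    gap p i j ≤ gap q i j := by
  obtain ⟨U, hU, hUZ⟩ := hO
  have hq' := hq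
  rw [← hUZ] at hq'
  -- By irreducibility U meets the open locus where the sum is at least as large as at p. The common
  -- point lies in O, on which the gaps are constant.
  obtain ⟨s, hsZ, hsU, hs⟩ := composites_irreducible hU
    (isOpen_le_finrank_sup i j (finrank k ↥(p.1.space i ⊔ p.2.space j))) hq'.2 hp hq'.1 (le_refl (finrank k _))
  have hsO : s ∈ O.orbit := by
    rw [← hUZ]
    exact ⟨hsU, hsZ⟩
  rw [gap_eq_of_mem_orbit hq hsO]
  exact (gap_le_iff_finrank_sup_le hp hsZ i j).2 hs

/-- On the open locus where every sum is at least as large as at q, maximality forces equal gaps,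
hence the same orbit. -/
theorem isOpenOrbitIn_of_gap_le {O O₁ O₂ : Orbit k n r} {q : Flag k n r × Flag k n r}
    (hq : q ∈ O.orbit) (hqZ : q ∈ composites O₁ O₂)
    (h : ∀ p ∈ composites O₁ O₂, ∀ i j, gap p i j ≤ gap q i j) :
    IsOpenOrbitIn O (composites O₁ O₂) := by
  refine ⟨⋂ i, ⋂ j, {p | finrank k ↥(q.1.space i ⊔ q.2.space j) ≤
    finrank k ↥(p.1.space i ⊔ p.2.space j)}, ?_, ?_⟩
  · let := zariskiFlags k n r
    exact isOpen_iInter_of_finite fun i => isOpen_iInter_of_finite fun j =>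
      isOpen_le_finrank_sup i j _
  · ext p
    simp only [Set.mem_inter_iff, Set.mem_iInter, Set.mem_ofPred_eq]
    constructor
    · rintro ⟨hp, hpZ⟩
      refine mem_orbit_of_gap_eq hq (funext fun i => funext fun j => ?_)
      exact le_antisymm ((gap_le_iff_finrank_sup_le hqZ hpZ i j).2 (hp i j)) (h p hpZ i j)
    · intro hp
      have hpZ : p ∈ composites O₁ O₂ := by
        obtain ⟨x, rfl⟩ := exists_smul_eq_of_mem_orbit hq hp
        exact smul_mem_composites hqZ x
      refine ⟨fun i j => (gap_le_iff_finrank_sup_le hqZ hpZ i j).1 ?_, hpZ⟩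
      rw [gap_eq_of_mem_orbit hq hp]

theorem IsOpenOrbitIn.unique [Infinite k] {O O' O₁ O₂ : Orbit k n r}
    (hO : IsOpenOrbitIn O (composites O₁ O₂)) (hO' : IsOpenOrbitIn O' (composites O₁ O₂)) :
    O' = O := by
  obtain ⟨q, hq, hqZ⟩ := hO.exists_mem
  obtain ⟨q', hq', hqZ'⟩ := hO'.exists_mem
  have : q' ∈ O.orbit := mem_orbit_of_gap_eq hq <| funext fun i => funext fun j =>
    le_antisymm (hO'.gap_le hq' hqZ i j) (hO.gap_le hq hqZ' i j)
  rw [mem_orbit_iff] at hq' this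
  exact hq'.symm.trans this

theorem orbitMul_eq [Infinite k] {R : Type*} [CommRing R] {O O₁ O₂ : Orbit k n r}
    (hO : IsOpenOrbitIn O (composites O₁ O₂)) : orbitMul k R O₁ O₂ = orbitBasis k R n r O := by
  have h : ∃! O : Orbit k n r, IsOpenOrbitIn O (composites O₁ O₂) := ⟨O, hO, fun _ h => hO.unique h⟩
  rw [orbitMul, dif_pos h, hO.unique h.choose_spec.1]

/-! ### Gaps of an open composite as a min-plus product. -/

/-- The dimension of `(1 + tN)X + Y` does not drop for generic `t`. -/
theorem exists_generic_finrank_one_add_smul (N : Matrix (Fin r) (Fin r) k)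
    (X Y : Submodule k (Fin r → k)) : ∃ D : Polynomial k, D ≠ 0 ∧ ∀ t, D.eval t ≠ 0 →
      finrank k ↥(X ⊔ Y) ≤ finrank k ↥(X.map (1 + t • N).mulVecLin ⊔ Y) := by
  obtain ⟨D, hD0, hD⟩ := exists_generic_finrank_sup (segment (1 + N)) 1 X Y
    (Polynomial.aeval 0 : _ →ₐ[k] k)
  refine ⟨D, fun h => hD0 (by rw [h, map_zero]), fun t ht => ?_⟩
  have hone : ∀ s : k, (1 : Matrix (Fin r) (Fin r) (Polynomial k)).map
      (Polynomial.aeval s : _ →ₐ[k] k) = 1 := fun s =>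
    Matrix.map_one _ (map_zero _) (map_one _)
  have := hD (Polynomial.aeval t : _ →ₐ[k] k) (by rwa [Polynomial.coe_aeval_eq_eval])
  rw [segment_map, segment_map, hone, hone, add_sub_cancel_left, zero_smul, add_zero,
    Matrix.mulVecLin_one, Submodule.map_id, Submodule.map_id] at this
  exact this

/-- A flag of maximal generality in its orbit under the stabiliser of `g`, with respect to one
subspace of the flag and one other subspace. -/
theorem exists_generic_flag [Infinite k] {f g : Flag k n r} {O : Orbit k n r}
    (hfg : (f, g) ∈ O.orbit) (i : Fin (n + 1)) (Y : Submodule k (Fin r → k)) :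
    ∃ f', (f', g) ∈ O.orbit ∧ ∀ (N : Matrix (Fin r) (Fin r) k),
      (∀ b, ∀ v ∈ g.space b, N *ᵥ v ∈ g.space b) → ∀ a, ∀ u ∈ f'.space i ⊓ g.space a, u ∈ Y →
        N *ᵥ u ∈ (f'.space i ⊓ g.space a) ⊔ Y := by
  -- f' maximises this bounded quantity. If Nu lay outside, replacing f' by (1 + tN)f' for generic t
  -- would fix g and increase it.
  let size : Flag k n r → ℕ := fun f' => ∑ a, finrank k ↥((f'.space i ⊓ g.space a) ⊔ Y)
  let T : Set ℕ := size '' {f' | (f', g) ∈ O.orbit}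
  have hbdd : BddAbove T := by
    refine ⟨∑ _a : Fin (n + 1), r, ?_⟩
    rintro _ ⟨f', _, rfl⟩
    refine Finset.sum_le_sum fun a _ => ?_
    simpa using Submodule.finrank_le ((f'.space i ⊓ g.space a) ⊔ Y)
  obtain ⟨f', hf', hmax⟩ := Nat.sSup_mem (s := T) ⟨_, f, hfg, rfl⟩ hbdd
  refine ⟨f', hf', fun N hN a u hu huY => ?_⟩
  by_contra hcon
  choose D hD0 hD using fun b => exists_generic_finrank_one_add_smul N (f'.space i ⊓ g.space b) Y
  -- Enlarging Y by Nu costs nothing after the perturbation: Nu = t⁻¹((1 + tN)u - u) with u in Y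
  -- already lies in the perturbed sum.
  obtain ⟨E, hE0, hE⟩ := exists_generic_finrank_one_add_smul N (f'.space i ⊓ g.space a)
    (Y ⊔ Submodule.span k {N *ᵥ u})
  have hdet : (segment (1 + N)).det ≠ 0 := fun h0 => by
    have := eval_det_segment (1 + N) 0
    simp [h0] at this
  obtain ⟨t, ht⟩ := Polynomial.exists_eval_ne_zero_of_infinite
    (mul_ne_zero (mul_ne_zero (Finset.prod_ne_zero_iff.2 fun b (_ : b ∈ Finset.univ) => hD0 b)
      hE0) (mul_ne_zero hdet Polynomial.X_ne_zero))
  simp only [Polynomial.eval_mul, mul_ne_zero_iff, eval_det_segment, Polynomial.eval_prod,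
    Finset.prod_ne_zero_iff, Polynomial.eval_X, add_sub_cancel_left] at ht
  obtain ⟨⟨htD, htE⟩, htdet, ht0⟩ := ht
  let P : Matrix.GeneralLinearGroup (Fin r) k := Matrix.GeneralLinearGroup.mkOfDetNeZero _ htdet
  have hPv : P.val = 1 + t • N := rfl
  have hPg : P • g = g := by
    refine smul_eq_self_of_map_le P g fun b v hv => ?_
    rw [hPv, Matrix.add_mulVec, Matrix.smul_mulVec, Matrix.one_mulVec]
    exact add_mem hv (Submodule.smul_mem _ _ (hN b v hv))
  have hPf : (P • f', g) ∈ O.orbit := by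
    have := smul_mem_orbit hf' P
    rwa [Prod.smul_mk, hPg] at this
  have hPX : ∀ b, (P • f').space i ⊓ g.space b =
      (f'.space i ⊓ g.space b).map (1 + t • N).mulVecLin := fun b => by
    rw [← hPv, Submodule.map_inf _ (mulVecLin_injective P), ← smul_space, ← smul_space, hPg]
  have hlt : size f' < size (P • f') := by
    refine Finset.sum_lt_sum (fun b _ => ?_) ⟨a, Finset.mem_univ _, ?_⟩
    · rw [hPX]
      exact hD b t (htD b (Finset.mem_univ _))
    · rw [hPX]
      refine lt_of_lt_of_le (Submodule.finrank_lt_finrank_of_lt ?_) ((hE t htE).trans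
        (Submodule.finrank_mono ?_))
      · refine lt_of_le_of_ne (sup_le_sup_left le_sup_left _) fun heq => hcon ?_
        rw [heq]
        exact Submodule.mem_sup_right
          (Submodule.mem_sup_right (Submodule.mem_span_singleton_self _))
      · refine sup_le le_sup_left (sup_le le_sup_right ?_)
        rw [Submodule.span_singleton_le_iff_mem]
        have h3 : N *ᵥ u = t⁻¹ • ((1 + t • N) *ᵥ u - u) := by
          rw [Matrix.add_mulVec, Matrix.one_mulVec, add_sub_cancel_left, Matrix.smul_mulVec,
            inv_smul_smul₀ ht0]
        rw [h3]
        exact Submodule.smul_mem _ _ (sub_mem (Submodule.mem_sup_left ⟨u, hu, rfl⟩)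
          (Submodule.mem_sup_right huY))
  have hle : size (P • f') ≤ sSup T := le_csSup hbdd ⟨_, hPf, rfl⟩
  omega

/-- Endomorphisms preserving a flag act transitively enough: a vector outside one step of the flag
can be mapped to any vector of the next step. -/
theorem exists_matrix_mulVec_eq (g : Flag k n r) (l : Fin n) {u w : Fin r → k}
    (hu : u ∉ g.space l.castSucc) (hw : w ∈ g.space l.succ) :
    ∃ N : Matrix (Fin r) (Fin r) k, (∀ b, ∀ v ∈ g.space b, N *ᵥ v ∈ g.space b) ∧ N *ᵥ u = w := by
  -- N has rank at most one: a functional that kills the smaller step but not u, times a multiple of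
  -- w.
  obtain ⟨φ, hφu, hφ⟩ := Submodule.exists_dual_map_eq_bot_of_notMem hu inferInstance
  have hker : ∀ v ∈ g.space l.castSucc, φ v = 0 := fun v hv => by
    have : φ v ∈ (g.space l.castSucc).map φ := ⟨v, hv, rfl⟩
    rwa [hφ, Submodule.mem_bot] at this
  refine ⟨LinearMap.toMatrix' (φ.smulRight ((φ u)⁻¹ • w)), fun b v hv => ?_, ?_⟩
  · rw [LinearMap.toMatrix'_mulVec, LinearMap.smulRight_apply]
    rcases le_or_gt b l.castSucc with hb | hb
    · rw [hker v (g.mono hb hv), zero_smul]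
      exact zero_mem _
    · exact Submodule.smul_mem _ _ (Submodule.smul_mem _ _
        (g.mono (Fin.castSucc_lt_iff_succ_le.1 hb) hw))
  · rw [LinearMap.toMatrix'_mulVec, LinearMap.smulRight_apply, smul_inv_smul₀ hφu]

/-- Let l be minimal with f'_i ∩ h_j ≤ g_l. If l > 0, some u in this intersection is outside
g_(l-1), and flag-preserving maps N send u to every vector of g_l. Genericity of f' then puts g_l
inside f'_i ∩ g_l + h_j, which is the equality criterion. -/
theorem exists_gap_add_eq [Infinite k] {f g h : Flag k n r} {O : Orbit k n r}
    (hfg : (f, g) ∈ O.orbit) (i j : Fin (n + 1)) :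
    ∃ f', (f', g) ∈ O.orbit ∧ ∃ l, gap (f', g) i l + gap (g, h) l j = gap (f', h) i j := by
  obtain ⟨f', hf', hgen⟩ := exists_generic_flag hfg i (h.space j)
  refine ⟨f', hf', ?_⟩
  have hex : ∃ l, f'.space i ⊓ h.space j ≤ g.space l :=
    ⟨Fin.last n, by rw [g.space_last]; exact le_top⟩
  obtain ⟨l, hl, hmin⟩ := WellFounded.has_min (wellFounded_lt (α := Fin (n + 1)))
    {l | f'.space i ⊓ h.space j ≤ g.space l} hex
  refine ⟨l, Submodule.relDim_add_of_sup_inf_eq hl ?_⟩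
  have hW : g.space l ≤ (f'.space i ⊓ g.space l) ⊔ h.space j := by
    rcases Fin.eq_zero_or_eq_succ l with rfl | ⟨l, rfl⟩
    · rw [g.space_zero]
      exact bot_le
    · have hnot : ¬ f'.space i ⊓ h.space j ≤ g.space l.castSucc := fun hle =>
        hmin _ hle Fin.castSucc_lt_succ
      obtain ⟨u, hu, hul⟩ := SetLike.not_le_iff_exists.1 hnot
      intro w hw
      obtain ⟨N, hN, rfl⟩ := exists_matrix_mulVec_eq g l hul hw
      exact hgen N hN _ u ⟨hu.1, hl hu⟩ hu.2
  dsimp only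
  rw [inf_comm (g.space l) (h.space j), ← sup_inf_assoc_of_le _ inf_le_right]
  exact le_inf hW le_rfl

/-- The generic f' gives another composite (f', h) through the same g, and its gaps are bounded by
those of the open orbit. -/
theorem IsOpenOrbitIn.exists_gap_add_eq [Infinite k] {O O₁ O₂ : Orbit k n r} {f g h : Flag k n r}
    (hO : IsOpenOrbitIn O (composites O₁ O₂)) (hfh : (f, h) ∈ O.orbit) (hfg : (f, g) ∈ O₁.orbit)
    (hgh : (g, h) ∈ O₂.orbit) (i j : Fin (n + 1)) :
    ∃ l, gap (f, h) i j = gap (f, g) i l + gap (g, h) l j := by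
  obtain ⟨f', hf', l, hl⟩ := ZeroSchur.exists_gap_add_eq (h := h) hfg i j
  refine ⟨l, le_antisymm (Submodule.relDim_triangle _ _ _) ?_⟩
  rw [gap_eq_of_mem_orbit hfg hf', hl]
  exact hO.gap_le hfh ⟨g, hf', hgh⟩ i j

/-! ### Diagonal entries of an open composite. -/

/-- If the relative position of `(f, h)` is the generic composite of those of `(f, g)` and `(g, h)`
and has no zero on the diagonal, then its diagonal is dominated by the diagonals of the factors. -/
theorem relMatrix_diag_le {f g h : Flag k n r}
    (hgap : ∀ j, ∃ l, gap (f, h) j j = gap (f, g) j l + gap (g, h) l j)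
    (hne : ∀ j, relMatrix (f, h) j j ≠ 0) (j : Fin n) :
    relMatrix (f, h) j j ≤ relMatrix (f, g) j j ∧
      relMatrix (f, h) j j ≤ relMatrix (g, h) j j := by
  choose l hl using hgap
  have htri : ∀ a b c, gap (f, h) a b ≤ gap (f, g) a c + gap (g, h) c b := fun a b c =>
    Submodule.relDim_triangle _ _ _
  -- If l did not increase at j, the triangle inequality at the two off-diagonal places together
  -- with `relDim_cross` would make the diagonal entry at most 0.
  have hmono : StrictMono l := by
    refine Fin.strictMono_iff_lt_succ.2 fun j => ?_
    by_contra! hle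
    have h1 := relMatrix_apply (f, h) j j
    have h2 := htri j.succ j.castSucc (l j.castSucc)
    have h3 := htri j.castSucc j.succ (l j.succ)
    have h4 : gap (f, g) j.succ (l j.castSucc) + gap (f, g) j.castSucc (l j.succ) ≤
        gap (f, g) j.succ (l j.succ) + gap (f, g) j.castSucc (l j.castSucc) :=
      Submodule.relDim_cross (f.mono Fin.castSucc_lt_succ.le) (g.mono hle)
    have h5 := hl j.succ
    have h6 := hl j.castSucc
    have h7 := hne j
    omega
  -- The only strictly increasing self-map of a finite chain is the identity.
  have hid : l = id := by
    refine (StrictMono.range_inj hmono strictMono_id).1 ?_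
    rw [(Finite.injective_iff_surjective.1 hmono.injective).range_eq, Set.range_id]
  subst hid
  simp only [id] at hl
  have h1 := relMatrix_apply (f, h) j j
  have h2 := relMatrix_apply (f, g) j j
  have h3 := relMatrix_apply (g, h) j j
  have h4 := hl j.succ
  have h5 := hl j.castSucc
  -- With l = id, the middle indices in `h6` and `h7` bound the entry by that of (f, g), and those
  -- in `h8` and `h9` by that of (g, h).
  have h6 := htri j.succ j.castSucc j.castSucc
  have h7 := htri j.castSucc j.succ j.succ
  have h8 := htri j.succ j.castSucc j.succ
  have h9 := htri j.castSucc j.succ j.castSucc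
  omega

theorem IsOpenOrbitIn.exists_diag_eq_zero [Infinite k] {O O₁ O₂ : Orbit k n r}
    (hO : IsOpenOrbitIn O (composites O₁ O₂))
    (h : (∃ i, O₁.matrix i i = 0) ∨ ∃ i, O₂.matrix i i = 0) : ∃ i, O.matrix i i = 0 := by
  by_contra! hne
  obtain ⟨⟨f, h'⟩, hq, g, hfg, hgh⟩ := hO.exists_mem
  have key := relMatrix_diag_le (fun j => hO.exists_gap_add_eq hq hfg hgh j j)
    (by rwa [relMatrix_of_mem_orbit hq])
  simp only [relMatrix_of_mem_orbit hq, relMatrix_of_mem_orbit hfg,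
    relMatrix_of_mem_orbit hgh] at key
  rcases h with ⟨i, hi⟩ | ⟨i, hi⟩
  · exact hne i (Nat.le_zero.1 (hi ▸ (key i).1))
  · exact hne i (Nat.le_zero.1 (hi ▸ (key i).2))


/-! ### Factorisation through a flag with a trivial step. -/

/-- The spaces of a flag, indexed by the natural numbers and constant from `n` on. -/
def Flag.nat (f : Flag k n r) (m : ℕ) : Submodule k (Fin r → k) :=
  f.space ⟨min m n, by omega⟩

theorem Flag.nat_mono (f : Flag k n r) : Monotone f.nat := fun a b h =>
  f.mono (by simp only [Fin.mk_le_mk]; omega)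

theorem Flag.nat_val (f : Flag k n r) (a : Fin (n + 1)) : f.nat a = f.space a := by
  unfold Flag.nat
  congr 1
  ext
  simp only
  omega

theorem Flag.nat_zero (f : Flag k n r) : f.nat 0 = ⊥ := by
  rw [← f.space_zero, ← f.nat_val, Fin.val_zero]

theorem Flag.nat_self (f : Flag k n r) : f.nat n = ⊤ := by
  rw [← f.space_last, ← f.nat_val, Fin.val_last]

/-- The spaces of `middleFlag`. -/
def middleSpace (f h : Flag k n r) (i m : ℕ) : Submodule k (Fin r → k) :=
  -- The formula changes between m = i and m = i + 1. Both formulas there give V_i + V_(i+1) ∩ V'_m,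
  -- so the quotient of these two spaces has the dimension of the diagonal entry.
  if m ≤ i then f.nat m ⊔ f.nat (m + 1) ⊓ h.nat m else f.nat (m - 1) ⊔ f.nat m ⊓ h.nat m

theorem middleSpace_mono (f h : Flag k n r) (i : ℕ) : Monotone (middleSpace f h i) := by
  refine monotone_nat_of_le_succ fun m => ?_
  have hf : f.nat m ≤ f.nat (m + 1) := f.nat_mono (Nat.le_succ m)
  have hh : h.nat m ≤ h.nat (m + 1) := h.nat_mono (Nat.le_succ m)
  have hf' : f.nat (m - 1) ≤ f.nat m := f.nat_mono (Nat.sub_le m 1)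
  unfold middleSpace
  rcases lt_trichotomy m i with hm | rfl | hm
  · rw [if_pos hm.le, if_pos (Nat.succ_le_of_lt hm)]
    exact le_sup_of_le_left (sup_le hf inf_le_left)
  · rw [if_pos le_rfl, if_neg (by omega), Nat.add_sub_cancel]
    exact sup_le_sup_left (inf_le_inf_left _ hh) _
  · rw [if_neg (by omega), if_neg (by omega), Nat.add_sub_cancel]
    exact le_sup_of_le_left (sup_le hf' inf_le_left)

/-- A flag between `f` and `h` such that the relative position of `(f, h)` is the generic composite
of the relative positions of `(f, g)` and `(g, h)`; its step `i` is measured by the entry `(i, i)`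
of the matrix of `(f, h)`. -/
def middleFlag (f h : Flag k n r) (i : Fin n) : Flag k n r where
  space a := middleSpace f h i a
  mono _ _ hab := middleSpace_mono f h i hab
  space_zero := by
    rw [Fin.val_zero, middleSpace, if_pos (Nat.zero_le _), f.nat_zero, h.nat_zero, inf_bot_eq,
      sup_bot_eq]
  space_last := by
    rw [Fin.val_last, middleSpace, if_neg (by omega), f.nat_self, h.nat_self, inf_top_eq,
      sup_top_eq]

theorem middleFlag_step_eq {f h : Flag k n r} {i : Fin n} (hi : relMatrix (f, h) i i = 0) :
    (middleFlag f h i).space i.castSucc = (middleFlag f h i).space i.succ := by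
  have e1 : (middleFlag f h i).space i.castSucc =
      f.space i.castSucc ⊔ f.space i.succ ⊓ h.space i.castSucc := by
    change middleSpace f h i i.castSucc = _
    rw [middleSpace, if_pos (by simp), f.nat_val, h.nat_val, ← f.nat_val i.succ, Fin.val_succ,
      Fin.val_castSucc]
  have e2 : (middleFlag f h i).space i.succ =
      f.space i.castSucc ⊔ f.space i.succ ⊓ h.space i.succ := by
    change middleSpace f h i i.succ = _
    rw [middleSpace, if_neg (by simp), f.nat_val, h.nat_val, ← f.nat_val i.castSucc, Fin.val_succ,
      Fin.val_castSucc, Nat.add_sub_cancel]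
  rw [relMatrix, Matrix.of_apply, Nat.sub_eq_zero_iff_le] at hi
  refine Submodule.eq_of_le_of_finrank_le
    ((middleFlag f h i).mono Fin.castSucc_lt_succ.le) ?_
  rw [e1, e2]
  exact hi

/-- The middle index is a when the comparison of a with b agrees with that of a with i; otherwise it
is a - 1 or a + 1, on the side towards b. Each choice meets one of the equality criteria for
`relDim`. -/
theorem exists_gap_middleFlag (f h : Flag k n r) (i : Fin n) (a b : Fin (n + 1)) :
    ∃ l, gap (f, middleFlag f h i) a l + gap (middleFlag f h i, h) l b = gap (f, h) a b := by
  have ha := a.2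
  have hb := b.2
  suffices H : ∃ l : ℕ, l ≤ n ∧
      ((f.nat a ⊓ h.nat b ≤ middleSpace f h i l ∧ middleSpace f h i l ≤ f.nat a) ∨
      (f.nat a ≤ middleSpace f h i l ∧ middleSpace f h i l ≤ f.nat a ⊔ h.nat b)) by
    obtain ⟨l, hl, H⟩ := H
    rw [f.nat_val, h.nat_val] at H
    refine ⟨⟨l, by omega⟩, ?_⟩
    rcases H with H | H
    · exact Submodule.relDim_add_of_inf_le H.1 H.2
    · exact Submodule.relDim_add_of_le_sup H.1 H.2
  rcases le_or_gt a.val i.val with hai | hai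
  · rcases le_or_gt a.val b.val with hab | hab
    · refine ⟨a, by omega, Or.inr ?_⟩
      rw [middleSpace, if_pos hai]
      exact ⟨le_sup_left, sup_le_sup_left (inf_le_right.trans (h.nat_mono hab)) _⟩
    · refine ⟨a - 1, by omega, Or.inl ?_⟩
      rw [middleSpace, if_pos (by omega), Nat.sub_add_cancel (by omega)]
      exact ⟨le_sup_of_le_right (inf_le_inf_left _ (h.nat_mono (by omega))),
        sup_le (f.nat_mono (by omega)) inf_le_left⟩
  · rcases le_or_gt b.val a.val with hab | hab
    · refine ⟨a, by omega, Or.inl ?_⟩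
      rw [middleSpace, if_neg (by omega)]
      exact ⟨le_sup_of_le_right (inf_le_inf_left _ (h.nat_mono hab)),
        sup_le (f.nat_mono (by omega)) inf_le_left⟩
    · refine ⟨a + 1, by omega, Or.inr ?_⟩
      rw [middleSpace, if_neg (by omega), Nat.add_sub_cancel]
      exact ⟨le_sup_left, sup_le_sup_left (inf_le_right.trans (h.nat_mono (by omega))) _⟩

theorem gap_self_of_le (g : Flag k n r) {a b : Fin (n + 1)} (h : a ≤ b) : gap (g, g) a b = 0 := by
  rw [gap, Submodule.relDim, sup_eq_right.2 (g.mono h), sub_self]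

theorem gap_self_of_ge (g : Flag k n r) {a b : Fin (n + 1)} (h : b ≤ a) :
    gap (g, g) a b = (finrank k (g.space a) : ℤ) - finrank k (g.space b) := by
  rw [gap, Submodule.relDim, sup_eq_left.2 (g.mono h)]

theorem relMatrix_self (g : Flag k n r) : relMatrix (g, g) =
    Matrix.diagonal fun i => finrank k (g.space i.succ) - finrank k (g.space i.castSucc) := by
  ext i j
  have h := relMatrix_apply (g, g) i j
  rcases lt_trichotomy i j with hij | rfl | hij
  · rw [Matrix.diagonal_apply_ne _ hij.ne]
    have h' : i.val < j.val := hij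
    rw [gap_self_of_le, gap_self_of_le, gap_self_of_le, gap_self_of_le] at h
    · simpa using h
    all_goals
      simp only [Fin.le_def, Fin.val_succ, Fin.val_castSucc]
      omega
  · rw [Matrix.diagonal_apply_eq]
    have := Submodule.finrank_mono (g.mono (Fin.castSucc_lt_succ (i := i)).le)
    rw [gap_self_of_ge g Fin.castSucc_lt_succ.le, gap_self_of_le g le_rfl, gap_self_of_le g le_rfl,
      gap_self_of_le g Fin.castSucc_lt_succ.le] at h
    omega
  · rw [Matrix.diagonal_apply_ne _ hij.ne']
    have h' : j.val < i.val := hij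
    rw [gap_self_of_ge, gap_self_of_ge, gap_self_of_ge, gap_self_of_ge] at h
    · omega
    all_goals
      simp only [Fin.le_def, Fin.val_succ, Fin.val_castSucc]
      omega

/-- The orbit of a pair of flags. -/
abbrev orbitOf (f h : Flag k n r) : Orbit k n r := Quotient.mk _ (f, h)

theorem mem_orbitOf (f h : Flag k n r) : (f, h) ∈ (orbitOf f h).orbit := mem_orbit_iff.2 rfl

theorem composites_orbitOf_self (f g : Flag k n r) :
    composites (orbitOf f g) (orbitOf g g) = (orbitOf f g).orbit := by
  ext ⟨a, c⟩
  constructor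
  · rintro ⟨b, hab, hbc⟩
    obtain ⟨x, hx⟩ := exists_smul_eq_of_mem_orbit (mem_orbitOf g g) hbc
    have h1 : x • g = b := congrArg Prod.fst hx
    have h2 : x • g = c := congrArg Prod.snd hx
    rw [← h2, h1]
    exact hab
  · intro hac
    obtain ⟨x, hx⟩ := exists_smul_eq_of_mem_orbit (mem_orbitOf f g) hac
    have h2 : x • g = c := congrArg Prod.snd hx
    refine ⟨c, hac, ?_⟩
    rw [← h2]
    exact smul_mem_orbit (mem_orbitOf g g) x

/-! ### The ideal generated by the boundary idempotents. -/

variable {R : Type*} [CommRing R]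

theorem orbitBasis_mul (O₁ O₂ : Orbit k n r) :
    orbitBasis k R n r O₁ * orbitBasis k R n r O₂ = orbitMul k R O₁ O₂ := by
  change mulBilin k R n r _ _ = _
  rw [mulBilin, Basis.constr_basis, Basis.constr_basis]

theorem orbitMul_orbitOf_self [Infinite k] (f g : Flag k n r) :
    orbitMul k R (orbitOf f g) (orbitOf g g) = orbitBasis k R n r (orbitOf f g) := by
  refine orbitMul_eq ⟨Set.univ, ?_, ?_⟩
  · exact @isOpen_univ _ (zariskiFlags k n r)
  · rw [composites_orbitOf_self, Set.univ_inter]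

/-- Every composite obeys the triangle bound, and (f, h) attains it at all indices, so its orbit is
open. -/
theorem orbitMul_middleFlag [Infinite k] (f h : Flag k n r) (i : Fin n) :
    orbitMul k R (orbitOf f (middleFlag f h i)) (orbitOf (middleFlag f h i) h) =
      orbitBasis k R n r (orbitOf f h) := by
  refine orbitMul_eq (isOpenOrbitIn_of_gap_le (mem_orbitOf f h)
    ⟨_, mem_orbitOf _ _, mem_orbitOf _ _⟩ ?_)
  rintro ⟨a, c⟩ ⟨b, hab, hbc⟩ s t
  obtain ⟨l, hl⟩ := exists_gap_middleFlag f h i s t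
  rw [← hl, gap_eq_of_mem_orbit (mem_orbitOf _ _) hab, gap_eq_of_mem_orbit (mem_orbitOf _ _) hbc]
  exact Submodule.relDim_triangle _ _ _

/-- With g the middle flag, e_(g,g) is a boundary idempotent; multiplying by e_(f,g) on the left and
e_(g,h) on the right yields e_(f,h). -/
theorem orbitBasis_mem_of_diag_eq_zero [Infinite k] {J : Submodule R (Alg k R n r)}
    (hJ : boundaryIdempotents k R n r ⊆ J)
    (hmul : ∀ x : Alg k R n r, ∀ y ∈ J, x * y ∈ J ∧ y * x ∈ J) {O : Orbit k n r}
    (hO : ∃ i, O.matrix i i = 0) : orbitBasis k R n r O ∈ J := by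
  obtain ⟨i, hi⟩ := hO
  induction O using Quotient.inductionOn with | _ p
  obtain ⟨f, h⟩ := p
  set g := middleFlag f h i with hg
  have h1 : orbitBasis k R n r (orbitOf g g) ∈ J := by
    refine hJ ⟨orbitOf g g, _, ⟨i, ?_⟩, relMatrix_self g, rfl⟩
    rw [hg, middleFlag_step_eq hi, Nat.sub_self]
  have h2 := (hmul (orbitBasis k R n r (orbitOf f g)) _ h1).1
  rw [orbitBasis_mul, orbitMul_orbitOf_self] at h2
  have h3 := (hmul (orbitBasis k R n r (orbitOf g h)) _ h2).2
  rwa [orbitBasis_mul, orbitMul_middleFlag] at h3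

theorem orbitMul_mem_span [Infinite k] {O₁ O₂ : Orbit k n r}
    (h : (∃ i, O₁.matrix i i = 0) ∨ ∃ i, O₂.matrix i i = 0) :
    orbitMul k R O₁ O₂ ∈
      Submodule.span R (orbitBasis k R n r '' {O | ∃ i, O.matrix i i = 0}) := by
  unfold orbitMul
  split_ifs with hex
  · exact Submodule.subset_span ⟨_, hex.choose_spec.1.exists_diag_eq_zero h, rfl⟩
  · exact zero_mem _

theorem mul_mem_span [Infinite k] (x : Alg k R n r) {y : Alg k R n r}
    (hy : y ∈ Submodule.span R (orbitBasis k R n r '' {O | ∃ i, O.matrix i i = 0})) :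
    x * y ∈ Submodule.span R (orbitBasis k R n r '' {O | ∃ i, O.matrix i i = 0}) ∧
    y * x ∈ Submodule.span R (orbitBasis k R n r '' {O | ∃ i, O.matrix i i = 0}) := by
  set J := Submodule.span R (orbitBasis k R n r '' {O | ∃ i, O.matrix i i = 0}) with hJ
  have hx : x ∈ Submodule.span R (Set.range (orbitBasis k R n r)) := by
    rw [Basis.span_eq]
    trivial
  constructor
  · refine Submodule.span_le (p := J.comap ((mulBilin k R n r).flip y)) |>.2 ?_ hx
    rintro _ ⟨O, rfl⟩
    refine Submodule.span_le (p := J.comap (mulBilin k R n r (orbitBasis k R n r O))) |>.2 ?_ hy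
    rintro _ ⟨O', hO', rfl⟩
    have := orbitMul_mem_span (R := R) (O₁ := O) (Or.inr hO')
    rwa [← orbitBasis_mul] at this
  · refine Submodule.span_le (p := J.comap (mulBilin k R n r y)) |>.2 ?_ hx
    rintro _ ⟨O, rfl⟩
    refine Submodule.span_le
      (p := J.comap ((mulBilin k R n r).flip (orbitBasis k R n r O))) |>.2 ?_ hy
    rintro _ ⟨O', hO', rfl⟩
    have := orbitMul_mem_span (R := R) (O₂ := O) (Or.inl hO')
    rwa [← orbitBasis_mul] at this

/-- The ideal generated by the boundary idempotents is spanned by the orbits whose matrix has a zero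
on the diagonal. -/
theorem boundaryIdeal_eq_span [Infinite k] : boundaryIdeal k R n r =
    Submodule.span R (orbitBasis k R n r '' {O | ∃ i, O.matrix i i = 0}) := by
  refine le_antisymm (sInf_le ⟨?_, fun x y hy => mul_mem_span x hy⟩) (le_sInf ?_)
  · rintro _ ⟨O, l, ⟨i, hi⟩, hO, rfl⟩
    refine Submodule.subset_span ⟨O, ⟨i, ?_⟩, rfl⟩
    rw [hO, Matrix.diagonal_apply_eq, hi]
  · rintro J ⟨hJ, hmul⟩
    refine Submodule.span_le.2 ?_
    rintro _ ⟨O, hO, rfl⟩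
    exact orbitBasis_mem_of_diag_eq_zero hJ hmul hO

end ZeroSchur

/-! ### Counting matrices and binomial identities. -/

theorem intBinom_of_neg {a b : ℤ} (h : b < 0) : intBinom a b = 0 := if_pos h

theorem intBinom_natCast (a : ℤ) (b : ℕ) : intBinom a b = Ring.choose a b := by
  rw [intBinom, if_neg (by omega), Int.toNat_natCast]

/-- The upper index is an integer: for a = b = 0 it is -1 and both sides are 1. -/
theorem natCast_multichoose_eq (a b : ℕ) :
    (a.multichoose b : ℤ) = Ring.choose ((a : ℤ) + b - 1) b := by
  rw [← Ring.multichoose_eq, Nat.multichoose_eq]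
  rfl

/-- Vandermonde's identity, with the range of summation of the upper indices of the first factor. -/
theorem sum_choose_mul_intBinom (n r : ℕ) (a : ℤ) :
    ∑ s ∈ Finset.range (n + 1), (n.choose s : ℤ) * intBinom a ((r : ℤ) + s - n) =
      Ring.choose (n + a) r := by
  -- Setting s = n - t turns the lower index into r - t. Terms with t > n or t > r vanish, so the
  -- range can be changed to that of Vandermonde.
  rw [← Finset.sum_range_reflect]
  have h1 : ∑ j ∈ Finset.range (n + 1), (n.choose (n + 1 - 1 - j) : ℤ) *
      intBinom a ((r : ℤ) + (n + 1 - 1 - j : ℕ) - n) =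
      ∑ t ∈ Finset.range (n + 1), (n.choose t : ℤ) * intBinom a ((r : ℤ) - t) := by
    refine Finset.sum_congr rfl fun t ht => ?_
    have ht' : t ≤ n := Nat.lt_succ_iff.1 (Finset.mem_range.1 ht)
    rw [Nat.add_sub_cancel, Nat.choose_symm ht', Nat.cast_sub ht']
    congr 2
    ring
  have h2 : ∑ t ∈ Finset.range (n + 1), (n.choose t : ℤ) * intBinom a ((r : ℤ) - t) =
      ∑ t ∈ Finset.range (n + r + 1), (n.choose t : ℤ) * intBinom a ((r : ℤ) - t) := by
    refine Finset.sum_subset (Finset.range_mono (by omega)) fun t _ ht => ?_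
    rw [Nat.choose_eq_zero_of_lt (by simpa using ht), Nat.cast_zero, zero_mul]
  have h3 : ∑ t ∈ Finset.range (r + 1), (n.choose t : ℤ) * intBinom a ((r : ℤ) - t) =
      ∑ t ∈ Finset.range (n + r + 1), (n.choose t : ℤ) * intBinom a ((r : ℤ) - t) := by
    refine Finset.sum_subset (Finset.range_mono (by omega)) fun t _ ht => ?_
    rw [Finset.mem_range] at ht
    rw [intBinom_of_neg (by omega), mul_zero]
  rw [h1, h2, ← h3, Ring.add_choose_eq r (Commute.all _ _),
    Finset.Nat.sum_antidiagonal_eq_sum_range_succ fun i j =>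
      Ring.choose (n : ℤ) i * Ring.choose a j]
  refine Finset.sum_congr rfl fun t ht => ?_
  have ht' : t ≤ r := Nat.lt_succ_iff.1 (Finset.mem_range.1 ht)
  rw [Ring.choose_natCast, ← Nat.cast_sub ht', intBinom_natCast]

theorem natCard_sum_eq (ι : Type*) [Fintype ι] [DecidableEq ι] (m : ℕ) :
    Nat.card {P : ι → ℕ // ∑ i, P i = m} = (Fintype.card ι).multichoose m := by
  rw [← Nat.card_congr (Sym.equivNatSumOfFintype ι m), Nat.card_eq_fintype_card,
    Sym.card_sym_eq_multichoose]

namespace ZeroSchur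

variable {k : Type*} [Field k] {n r : ℕ}

/-- Orbits correspond to matrices of natural numbers whose entries have sum `r`. -/
noncomputable def orbitEquiv (k : Type*) [Field k] (n r : ℕ) :
    Orbit k n r ≃ {P : Fin n × Fin n → ℕ // ∑ c, P c = r} :=
  Equiv.ofBijective
    (fun O => ⟨fun c => O.matrix c.1 c.2, by rw [Fintype.sum_prod_type]; exact O.sum_matrix⟩) <| by
    constructor
    · intro O O' h
      refine Orbit.matrix_injective (Matrix.ext fun i j => ?_)
      exact congrFun (congrArg Subtype.val h) (i, j)
    · rintro ⟨P, hP⟩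
      rw [Fintype.sum_prod_type] at hP
      obtain ⟨O, hO⟩ := exists_orbit_matrix_eq (k := k) (Matrix.of fun i j => P (i, j)) hP
      refine ⟨O, Subtype.ext (funext fun c => ?_)⟩
      simp [hO]

instance : Finite (Orbit k n r) :=
  Finite.of_equiv _ ((Sym.equivNatSumOfFintype (Fin n × Fin n) r).trans (orbitEquiv k n r).symm)

theorem natCard_orbit : Nat.card (Orbit k n r) = (n * n).multichoose r := by
  rw [Nat.card_congr (orbitEquiv k n r), natCard_sum_eq]
  simp

/-- Subtracting the identity matrix. -/
noncomputable def positiveOrbitEquiv (k : Type*) [Field k] (n r : ℕ) :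
    {O : Orbit k n r // ∀ i, O.matrix i i ≠ 0} ≃
      {P : Fin n × Fin n → ℕ // ∑ c, P c + n = r} := by
  have hsum : ∑ c : Fin n × Fin n, (if c.1 = c.2 then 1 else 0) = n := by
    rw [Fintype.sum_prod_type]
    simp
  refine Equiv.ofBijective
    (fun O => ⟨fun c => O.1.matrix c.1 c.2 - if c.1 = c.2 then 1 else 0, ?_⟩) ⟨?_, ?_⟩
  · refine (congrArg (_ + ·) hsum.symm).trans ?_
    refine Eq.trans ?_ ((Fintype.sum_prod_type' O.1.matrix).trans O.1.sum_matrix)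
    rw [← Finset.sum_add_distrib]
    refine Finset.sum_congr rfl fun c _ => Nat.sub_add_cancel ?_
    split_ifs with hc
    · rw [← hc]
      exact Nat.pos_of_ne_zero (O.2 c.1)
    · exact Nat.zero_le _
  · rintro ⟨O, hO⟩ ⟨O', hO'⟩ h
    refine Subtype.ext (Orbit.matrix_injective (Matrix.ext fun i j => ?_))
    have h' := congrFun (congrArg Subtype.val h) (i, j)
    dsimp only at h' ⊢
    split_ifs at h' with hij
    · subst hij
      have := hO i
      have := hO' i
      omega
    · simpa using h'
  · rintro ⟨P, hP⟩
    obtain ⟨O, hO⟩ := exists_orbit_matrix_eq (k := k) (r := r)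
      (Matrix.of fun i j => P (i, j) + if i = j then 1 else 0) (by
        refine Eq.trans ?_ ((congrArg (_ + ·) hsum).trans hP)
        rw [← Finset.sum_add_distrib, Fintype.sum_prod_type]
        rfl)
    refine ⟨⟨O, fun i => by simp [hO]⟩, Subtype.ext (funext fun c => ?_)⟩
    simp [hO]

theorem natCard_positiveOrbit :
    (Nat.card {O : Orbit k n r // ∀ i, O.matrix i i ≠ 0} : ℤ) =
      intBinom ((n : ℤ) ^ 2 + r - n - 1) ((r : ℤ) - n) := by
  rw [Nat.card_congr (positiveOrbitEquiv k n r)]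
  rcases le_or_gt n r with h | h
  · obtain ⟨m, rfl⟩ := Nat.exists_eq_add_of_le' h
    simp only [Nat.add_right_cancel_iff]
    rw [natCard_sum_eq, natCast_multichoose_eq, ← intBinom_natCast]
    congr 1 <;> push_cast [Fintype.card_prod, Fintype.card_fin] <;> ring
  · rw [intBinom_of_neg (by omega)]
    have : IsEmpty {P : Fin n × Fin n → ℕ // ∑ c, P c + n = r} := ⟨fun P => by
      have := P.2
      omega⟩
    simp

/-- Vandermonde for n + (n² + r - n - 1) = n² + r - 1 writes the number of all orbits as a sum over
s from 0 to n. Its term s = 0 counts the orbits with positive diagonal. -/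
theorem natCard_boundaryOrbit :
    (Nat.card {O : Orbit k n r // ∃ i, O.matrix i i = 0} : ℤ) =
      ∑ s ∈ Finset.Icc 1 n,
        (n.choose s : ℤ) * intBinom ((n : ℤ) ^ 2 + r - n - 1) ((r : ℤ) + s - n) := by
  classical
  have h1 := Nat.card_congr (Equiv.sumCompl fun O : Orbit k n r => ∃ i, O.matrix i i = 0)
  rw [Nat.card_sum, natCard_orbit] at h1
  have h2 : Nat.card {O : Orbit k n r // ¬ ∃ i, O.matrix i i = 0} =
      Nat.card {O : Orbit k n r // ∀ i, O.matrix i i ≠ 0} :=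
    Nat.card_congr (Equiv.subtypeEquivRight fun O => not_exists)
  have h3 := natCard_positiveOrbit (k := k) (n := n) (r := r)
  have h4 := sum_choose_mul_intBinom n r ((n : ℤ) ^ 2 + r - n - 1)
  have h5 : ∑ s ∈ Finset.range (n + 1),
      (n.choose s : ℤ) * intBinom ((n : ℤ) ^ 2 + r - n - 1) ((r : ℤ) + s - n) =
      ∑ s ∈ Finset.Icc 1 n,
        (n.choose s : ℤ) * intBinom ((n : ℤ) ^ 2 + r - n - 1) ((r : ℤ) + s - n) +
      intBinom ((n : ℤ) ^ 2 + r - n - 1) ((r : ℤ) - n) := by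
    rw [Finset.range_eq_Ico, Finset.sum_eq_sum_Ico_succ_bot (Nat.succ_pos n), add_comm]
    simp [Finset.Ico_add_one_right_eq_Icc]
  have h6 := natCast_multichoose_eq (n * n) r
  rw [show (n : ℤ) + ((n : ℤ) ^ 2 + r - n - 1) = ((n * n : ℕ) : ℤ) + r - 1 by push_cast; ring,
    ← h6, h5, ← h3, ← h1, h2] at h4
  push_cast at h4
  linarith

/-! ### Bases of the ideal and of the quotient. -/

variable {R : Type*} [CommRing R]

/-- The basis of the boundary ideal given by the orbits whose matrix has a zero on the diagonal. -/
noncomputable def boundaryBasis (k : Type*) [Field k] [Infinite k] (R : Type*) [CommRing R]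
    (n r : ℕ) : Basis {O : Orbit k n r // ∃ i, O.matrix i i = 0} R (boundaryIdeal k R n r) :=
  (Basis.span ((orbitBasis k R n r).linearIndependent.comp _ Subtype.val_injective)).map
    (LinearEquiv.ofEq _ _ (by
      rw [boundaryIdeal_eq_span, Set.range_comp, Subtype.range_coe_subtype]))

theorem boundaryBasis_apply [Infinite k] (O : {O : Orbit k n r // ∃ i, O.matrix i i = 0}) :
    (boundaryBasis k R n r O : Alg k R n r) = orbitBasis k R n r O.1 := by
  rw [boundaryBasis, Basis.map_apply, LinearEquiv.coe_ofEq_apply, Basis.coe_span_apply]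
  rfl

/-- The basis of the quotient by the boundary ideal given by the orbits whose matrix has no zero on
the diagonal. -/
noncomputable def quotientBasis (k : Type*) [Field k] [Infinite k] (R : Type*) [CommRing R]
    (n r : ℕ) : Basis {O : Orbit k n r // ∀ i, O.matrix i i ≠ 0} R
      (Alg k R n r ⧸ boundaryIdeal k R n r) :=
  have hc : IsCompl (boundaryIdeal k R n r)
      (Submodule.span R (Set.range (orbitBasis k R n r ∘ Subtype.val :
        {O : Orbit k n r // ∀ i, O.matrix i i ≠ 0} → Alg k R n r))) := by
    rw [boundaryIdeal_eq_span, Set.range_comp, Subtype.range_coe_subtype]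
    refine (orbitBasis k R n r).linearIndependent.isCompl_span_image (orbitBasis k R n r).span_eq ?_
    have h : {O : Orbit k n r | ∀ i, O.matrix i i ≠ 0} = {O | ∃ i, O.matrix i i = 0}ᶜ := by
      ext O
      simp
    rw [h]
    exact isCompl_compl
  (Basis.span ((orbitBasis k R n r).linearIndependent.comp _ Subtype.val_injective)).map
    (Submodule.quotientEquivOfIsCompl _ _ hc).symm

end ZeroSchur

theorem mainTheorem11 {k : Type*} [Field k] [IsAlgClosed k] {R : Type*} [CommRing R] [Nontrivial R]
    (n r : ℕ) :
    (∃ b : Module.Basis {O : ZeroSchur.Orbit k n r // ∃ i, O.matrix i i = 0} R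
        (ZeroSchur.boundaryIdeal k R n r),
      ∀ O, (b O : ZeroSchur.Alg k R n r) = ZeroSchur.orbitBasis k R n r O.1) ∧
    (Module.Free R (ZeroSchur.boundaryIdeal k R n r) ∧
      Module.Finite R (ZeroSchur.boundaryIdeal k R n r) ∧
      (Module.finrank R (ZeroSchur.boundaryIdeal k R n r) : ℤ) =
        ∑ s ∈ Finset.Icc 1 n,
          (n.choose s : ℤ) * intBinom ((n : ℤ) ^ 2 + r - n - 1) ((r : ℤ) + s - n)) ∧
    (Module.Free R (ZeroSchur.Alg k R n r ⧸ ZeroSchur.boundaryIdeal k R n r) ∧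
      Module.Finite R (ZeroSchur.Alg k R n r ⧸ ZeroSchur.boundaryIdeal k R n r) ∧
      (Module.finrank R (ZeroSchur.Alg k R n r ⧸ ZeroSchur.boundaryIdeal k R n r) : ℤ) =
        intBinom ((n : ℤ) ^ 2 + r - n - 1) ((r : ℤ) - n)) := by
  let b := ZeroSchur.boundaryBasis k R n r
  let q := ZeroSchur.quotientBasis k R n r
  refine ⟨⟨b, ZeroSchur.boundaryBasis_apply⟩,
    ⟨Module.Free.of_basis b, Module.Finite.of_basis b, ?_⟩,
    ⟨Module.Free.of_basis q, Module.Finite.of_basis q, ?_⟩⟩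
  · rw [Module.finrank_eq_nat_card_basis b, ZeroSchur.natCard_boundaryOrbit]
  · rw [Module.finrank_eq_nat_card_basis q, ZeroSchur.natCard_positiveOrbit]
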